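/- Let $B\subset\mathbb{R}^2$ be the open unit disc, let $m\ge 1$, and let $A=(A_{pq}):B\times\mathbb{R}^{m\times 2}\to\mathbb{R}^{m\times 2}$ satisfy (summing over repeated indices): (H1) for each $x\in B$ the map $F\mapsto A(x,F)$ is $C^1$, and there is $\nu>0$, independent of $x$ and $F$, such that $$\frac{\partial A_{pq}}{\partial F_{rs}}(x,F)\,a_p b_q a_r b_s\ \ge\ \nu\,|a|^2|b|^2\qquad\text{for all }x\in B,\ F\in\mathbb{R}^{m\times 2},\ a\in\mathbb{R}^m,\ b\in\mathbb{R}^2;$$ (H2) for $i=1,2$ the partial derivative $\partial_{x_i}A(x,F)$ (with $F$ held fixed) exists at all points of $(B\setminus\{0\})\times\mathbb{R}^{m\times 2}$, and $(x,F)\mapsto |x|\,\partial_{x_i}A(x,F)$ is continuous on this set. Let $u\in W^{1,2}(B,\mathbb{R}^m)$ be positively one-homogeneous, i.e. $u(\lambda x)=\lambda u(x)$ whenever $\lambda\ge 0$ and $x,\lambda x\in B$, and suppose that $u$ solves $\frac{\partial}{\partial x_q}A_{pq}(x,\nabla u)=0$, $1\le p\le m$, in $B$ in the sense of distributions: $A(x,\nabla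 u)\in L^1_{\rm loc}(B)$ and $$\int_B A(x,\nabla u)\cdot\nabla\varphi\,dx=0\qquad\text{for all }\varphi\in C^1_c(B,\mathbb{R}^m).$$ Suppose moreover that (H3) for $i=1,2$, writing $R=|x|$, $\lim_{R\to 0}R\,(\partial_{x_i}A)(x,\nabla u(x))=0$ along almost every ray from the origin (null sets of radii being disregarded, as $\nabla u$ is defined only almost everywhere). Then $u$ is linear: there is a linear map $L:\mathbb{R}^2\to\mathbb{R}^m$ with $u(x)=Lx$ for almost every $x\in B$. -/

import Mathlib

open MeasureTheory Filter Topology Set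
open scoped ContDiff

/-- The Euclidean plane. -/
abbrev Plane : Type := EuclideanSpace ℝ (Fin 2)

/-- Real `m × 2` matrices, `F p q` being the entry in row `p` and column `q`. Only their topology,
differentiability and integrability are used, so the choice of the norm is immaterial. -/
abbrev Mat (m : ℕ) : Type := Fin m → Fin 2 → ℝ

/-- The open unit disc `B`. -/
def unitDisc : Set Plane := Metric.ball 0 1

/-- The coordinate vector `e_i` of the plane. -/
noncomputable def coordVec (i : Fin 2) : Plane := EuclideanSpace.single i (1 : ℝ)

/-- The point of the plane with polar coordinates `(R, θ)`. -/
noncomputable def polarPoint (R θ : ℝ) : Plane := !₂[R * Real.cos θ, R * Real.sin θ]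

/-- `Du` is the weak (distributional) gradient of `u` on the unit disc: `Du p i = ∂u_p/∂x_i`. -/
def IsWeakGradient {m : ℕ} (u : Plane → EuclideanSpace ℝ (Fin m)) (Du : Plane → Mat m) : Prop :=
  ∀ φ : Plane → ℝ, ContDiff ℝ ∞ φ → HasCompactSupport φ → tsupport φ ⊆ unitDisc →
    ∀ (p : Fin m) (i : Fin 2),
      ∫ x in unitDisc, u x p * fderiv ℝ φ x (coordVec i) = - ∫ x in unitDisc, Du x p i * φ x

/-- `u` belongs to `W^{1,2}(B, ℝ^m)`, and `Du` is (a representative of) its weak gradient. -/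
structure IsW12WithGradient {m : ℕ} (u : Plane → EuclideanSpace ℝ (Fin m))
    (Du : Plane → Mat m) : Prop where
  memLp : MemLp u 2 (volume.restrict unitDisc)
  memLp_grad : MemLp Du 2 (volume.restrict unitDisc)
  weakGradient : IsWeakGradient u Du

/-- `u` is (positively) one-homogeneous on the unit disc. -/
def IsOneHomogeneous {m : ℕ} (u : Plane → EuclideanSpace ℝ (Fin m)) : Prop :=
  ∀ x ∈ unitDisc, ∀ t : ℝ, 0 ≤ t → t • x ∈ unitDisc → u (t • x) = t • u x

/-- A function with gradient `Du` solves `∂/∂x_q A_{pq}(x, ∇u) = 0`, `1 ≤ p ≤ m`, in the unit disc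
in the sense of distributions: `A(x, ∇u)` is locally integrable and
`∫_B A(x, ∇u) · ∇φ dx = 0` for all `φ ∈ C_c^1(B, ℝ^m)`. -/
structure IsDistributionalSolution {m : ℕ} (A : Plane → Mat m → Mat m)
    (Du : Plane → Mat m) : Prop where
  locallyIntegrable : LocallyIntegrableOn (fun x => A x (Du x)) unitDisc volume
  equation : ∀ φ : Plane → EuclideanSpace ℝ (Fin m),
    ContDiff ℝ 1 φ → HasCompactSupport φ → tsupport φ ⊆ unitDisc →
      ∫ x in unitDisc, ∑ p : Fin m, ∑ q : Fin 2,
        A x (Du x) p q * (fderiv ℝ φ x (coordVec q)) p = 0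

/-- The partial derivative `∂A_{pq}/∂F_{rs}` at `(x, F)`. -/
noncomputable def partialF {m : ℕ} (A : Plane → Mat m → Mat m) (x : Plane) (F : Mat m)
    (p : Fin m) (q : Fin 2) (r : Fin m) (s : Fin 2) : ℝ :=
  fderiv ℝ (A x) F (Pi.single r (Pi.single s (1 : ℝ))) p q

/-- The partial derivative `∂A/∂x_i` at `(x, F)`, taken with `F` held fixed. -/
noncomputable def partialX {m : ℕ} (A : Plane → Mat m → Mat m) (i : Fin 2) (x : Plane)
    (F : Mat m) : Mat m :=
  lineDeriv ℝ (fun y => A y F) x (coordVec i)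

/-- `A(x, F)` is `C^1` in the argument `F`, for each `x ∈ B`. -/
def IsC1InGradient {m : ℕ} (A : Plane → Mat m → Mat m) : Prop :=
  ∀ x ∈ unitDisc, ContDiff ℝ 1 (A x)

/-- Uniform ellipticity (Legendre–Hadamard): `∂A_{pq}/∂F_{rs}(x, F) a_p b_q a_r b_s ≥ ν |a|² |b|²`
with a constant `ν > 0` independent of `x` and `F`. -/
def IsUniformlyElliptic {m : ℕ} (A : Plane → Mat m → Mat m) : Prop :=
  ∃ ν : ℝ, 0 < ν ∧ ∀ x ∈ unitDisc, ∀ F : Mat m, ∀ (a : EuclideanSpace ℝ (Fin m)) (b : Plane),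
    ν * ‖a‖ ^ 2 * ‖b‖ ^ 2 ≤
      ∑ p : Fin m, ∑ q : Fin 2, ∑ r : Fin m, ∑ s : Fin 2,
        partialF A x F p q r s * a p * b q * a r * b s

/-- The partial derivatives `∂A/∂x_i` exist on `(B \ {0}) × ℝ^{m × 2}`, and `|x| ∂A/∂x_i (x, F)` is
continuous there. -/
def HasContinuousSpatialDerivatives {m : ℕ} (A : Plane → Mat m → Mat m) : Prop :=
  ∀ i : Fin 2,
    (∀ x ∈ unitDisc \ {0}, ∀ F : Mat m, LineDifferentiableAt ℝ (fun y => A y F) x (coordVec i)) ∧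
    ContinuousOn (fun z : Plane × Mat m => ‖z.1‖ • partialX A i z.1 z.2)
      ((unitDisc \ {0}) ×ˢ (univ : Set (Mat m)))

/-- `R ∂A/∂x_i (x, ∇u) → 0` as `R = |x| → 0`, along almost every ray. Since `∇u` is defined almost
everywhere only, the limit on a ray disregards null sets of radii; so the condition does not depend
on the representative `Du` of the gradient. -/
def SpatialDerivativeVanishes {m : ℕ} (A : Plane → Mat m → Mat m) (Du : Plane → Mat m) : Prop :=
  ∀ i : Fin 2, ∀ᵐ θ : ℝ,
    Tendsto (fun R : ℝ => R • partialX A i (polarPoint R θ) (Du (polarPoint R θ)))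
      (𝓝[>] (0 : ℝ) ⊓ ae volume) (𝓝 0)

/-!
In polar coordinates a one-homogeneous map is `u = R g(θ)`, with gradient
`∇u = g ⊗ e_R + g' ⊗ e_θ`, which depends on the angle only. Linearity of `u` amounts to `g'' = -g`,
since then `g = a cos θ + b sin θ`. The argument is local in `θ`, so it is carried out on the disc
slit along the negative real axis, that is on the rectangle `polarRect` of the coordinates `(R, θ)`.

With `a = A(x, ∇u)` the equation reads `∂(R a e_R)/∂R + ∂(a e_θ)/∂θ = 0`. If `g` were of class `C²`,
one could expand the derivatives; the terms which come from the rotation of the frame cancel, and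
what is left is `A_F[(g'' + g) ⊗ e_θ] e_θ = -R div_x A(x, F)|_{F = ∇u}`. Ellipticity in the direction
`(g'' + g) ⊗ e_θ` then gives `ν |g'' + g| ≤ |R div_x A(x, ∇u)|`. The left-hand side does not depend on
`R`, and the right-hand side tends to zero with `R` along almost every ray. Hence `g'' = -g`.

The work lies in the regularity of `g`, which is a priori of class `W^{1,2}` only.

* `exists_polar_structure`: the weak gradient has the stated form `g ⊗ e_R + ξ ⊗ e_θ`, with `g` a
  primitive of an integrable function `ξ` of the angle.
* Averaging the equation in the radius shows that the averaged flux `∫ R β(R) A(x, ∇u) e_θ dR` agrees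
  almost everywhere with a continuous function of `θ`
  (`IsDistributionalSolution.exists_continuousOn_average`). By ellipticity this flux is a strongly
  monotone function of `ξ` (`le_inner_averagedFlux_sub`), so that `ξ` has a continuous
  representative (`exists_continuousOn_ae_eq_of_monotone`).
* With `∇u` continuous away from the origin, the equation holds on every single circle, in the
  classical sense (`hasDerivAt_angularPart_of_weak`). Comparing `ξ` with the affine function whose
  flux is the same to first order, strong monotonicity shows that `ξ` is differentiable, with the
  bound above for `ξ' + g` (`exists_hasDerivAt_of_flux`).
* So `ξ'` exists everywhere and equals `-g` almost everywhere, which is enough to integrate the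
  equation (`eq_cos_add_sin_of_ae`).
-/

/-! ### Distributional derivatives on an interval -/

/-- Integration by parts for the primitive of an integrable function. -/
theorem integral_primitive_mul_deriv {H η : ℝ → ℝ} {a b c : ℝ} (hab : a ≤ b) (hc : c ∈ Icc a b)
    (hH : IntegrableOn H (Ioo a b)) (hη : ContDiff ℝ 1 η) (hηa : η a = 0) (hηb : η b = 0) :
    ∫ t in Ioo a b, (∫ s in c..t, H s) * deriv η t = -∫ t in Ioo a b, H t * η t := by
  have hHi : IntervalIntegrable H volume a b :=
    (intervalIntegrable_iff_integrableOn_Ioo_of_le hab).2 hH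
  have hc' : c ∈ uIcc a b := by rwa [uIcc_of_le hab]
  have hac := hHi.absolutelyContinuousOnInterval_intervalIntegral hc'
  have hηac : AbsolutelyContinuousOnInterval η a b := hη.contDiffOn.absolutelyContinuousOnInterval
  have key := hac.integral_mul_deriv_eq_deriv_mul hηac
  rw [hηa, hηb, mul_zero, mul_zero, sub_zero, zero_sub] at key
  rw [← integral_Ioc_eq_integral_Ioo, ← integral_Ioc_eq_integral_Ioo,
    ← intervalIntegral.integral_of_le hab, ← intervalIntegral.integral_of_le hab, key]
  congr 1
  refine intervalIntegral.integral_congr_ae ?_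
  filter_upwards [hHi.ae_hasDerivAt_integral] with x hx hx'
  rw [(hx (uIoc_subset_uIcc hx') c hc').deriv]

theorem exists_Icc_of_isCompact_subset_Ioo {K : Set ℝ} {a b : ℝ} (hab : a < b) (hK : IsCompact K)
    (h : K ⊆ Ioo a b) : ∃ α β, a < α ∧ α ≤ β ∧ β < b ∧ K ⊆ Icc α β := by
  rcases K.eq_empty_or_nonempty with rfl | hne
  · obtain ⟨m, hm⟩ := nonempty_Ioo.2 hab
    exact ⟨m, m, hm.1, le_rfl, hm.2, empty_subset _⟩
  · refine ⟨sInf K, sSup K, (h (hK.sInf_mem hne)).1, ?_, (h (hK.sSup_mem hne)).2, ?_⟩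
    · exact csInf_le_csSup hne hK.bddBelow hK.bddAbove
    · exact fun x hx => ⟨csInf_le hK.bddBelow hx, le_csSup hK.bddAbove hx⟩

theorem exists_bump_integral_eq_one {a b : ℝ} (hab : a < b) :
    ∃ β : ℝ → ℝ, ContDiff ℝ ∞ β ∧ HasCompactSupport β ∧ tsupport β ⊆ Ioo a b ∧
      (∀ t, 0 ≤ β t) ∧ ∫ t, β t = 1 := by
  let f : ContDiffBump ((a + b) / 2) := ⟨(b - a) / 8, (b - a) / 4, by linarith, by linarith⟩
  refine ⟨f.normed volume, f.contDiff_normed, f.hasCompactSupport_normed, ?_, f.nonneg_normed,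
    f.integral_normed⟩
  rw [f.tsupport_normed_eq, Real.closedBall_eq_Icc]
  intro x hx
  have h1 : f.rOut = (b - a) / 4 := rfl
  rw [h1] at hx
  exact ⟨by linarith [hx.1], by linarith [hx.2]⟩

theorem integral_mul_bump_pos {β : ℝ → ℝ} (hβ : Continuous β) (hβs : tsupport β ⊆ Ioo 0 1)
    (hβ0 : ∀ t, 0 ≤ β t) (hβ1 : ∫ t, β t = 1) : 0 < ∫ R in Ioo (0 : ℝ) 1, R * β R := by
  have hnonneg : 0 ≤ᵐ[volume.restrict (Ioo (0 : ℝ) 1)] fun R => R * β R :=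
    (ae_restrict_iff' measurableSet_Ioo).2 (ae_of_all _ fun R hR => mul_nonneg hR.1.le (hβ0 R))
  refine (integral_nonneg_of_ae hnonneg).lt_of_ne' fun h0 => ?_
  have hi : IntegrableOn (fun R => R * β R) (Ioo 0 1) :=
    ((continuous_id.mul hβ).continuousOn.integrableOn_compact isCompact_Icc).mono_set
      Ioo_subset_Icc_self
  have h1 := (setIntegral_eq_zero_iff_of_nonneg_ae hnonneg hi).1 h0
  have h2 : ∫ R in Ioo (0 : ℝ) 1, β R = 0 := by
    refine integral_eq_zero_of_ae ?_
    filter_upwards [h1, ae_restrict_mem measurableSet_Ioo] with R hR hR'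
    exact (mul_eq_zero.1 hR).resolve_left hR'.1.ne'
  rw [setIntegral_eq_integral_of_forall_compl_eq_zero fun R hR =>
    image_eq_zero_of_notMem_tsupport fun h => hR (hβs h), hβ1] at h2
  exact one_ne_zero h2

theorem continuousOn_primitive_of_integrableOn {H : ℝ → ℝ} {a b c : ℝ} (hab : a ≤ b)
    (hc : c ∈ Icc a b) (hH : IntegrableOn H (Ioo a b)) :
    ContinuousOn (fun t => ∫ s in c..t, H s) (Icc a b) := by
  have hHi : IntervalIntegrable H volume a b :=
    (intervalIntegrable_iff_integrableOn_Ioo_of_le hab).2 hH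
  have := (hHi.absolutelyContinuousOnInterval_intervalIntegral
    (c := c) (by rwa [uIcc_of_le hab])).continuousOn
  rwa [uIcc_of_le hab] at this

/-- A test function of mean zero on an interval is the derivative of a test function. -/
theorem exists_deriv_eq_of_integral_eq_zero {χ : ℝ → ℝ} {a b : ℝ} (hab : a < b)
    (hχ : ContDiff ℝ ∞ χ) (hc : HasCompactSupport χ) (hs : tsupport χ ⊆ Ioo a b)
    (h0 : ∫ t, χ t = 0) :
    ∃ η : ℝ → ℝ, ContDiff ℝ ∞ η ∧ HasCompactSupport η ∧ tsupport η ⊆ Ioo a b ∧ deriv η = χ := by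
  obtain ⟨α, β, haα, hαβ, hβb, hK⟩ := exists_Icc_of_isCompact_subset_Ioo hab hc hs
  have hder : ∀ t, HasDerivAt (fun t => ∫ s in a..t, χ s) (χ t) t := fun t =>
    intervalIntegral.integral_hasDerivAt_right (hχ.continuous.intervalIntegrable _ _)
      (hχ.continuous.stronglyMeasurableAtFilter _ _) hχ.continuous.continuousAt
  have hderiv : deriv (fun t => ∫ s in a..t, χ s) = χ := funext fun t => (hder t).deriv
  have hzero : ∀ s, s ∉ Icc α β → χ s = 0 := fun s h =>
    image_eq_zero_of_notMem_tsupport fun h' => h (hK h')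
  have hsupp : tsupport (fun t => ∫ s in a..t, χ s) ⊆ Icc α β := by
    refine closure_minimal (fun t ht => ?_) isClosed_Icc
    by_contra hcon
    refine ht ?_
    rcases lt_or_ge t α with h | h
    · refine intervalIntegral.integral_zero_ae (ae_of_all _ fun s hs' => hzero s fun h2 => ?_)
      rcases le_total a t with h3 | h3
      · rw [uIoc_of_le h3] at hs'; linarith [hs'.2, h2.1]
      · rw [uIoc_of_ge h3] at hs'; linarith [hs'.2, h2.1]
    · have h' : β < t := not_le.1 fun h' => hcon ⟨h, h'⟩
      change ∫ s in a..t, χ s = 0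
      rw [intervalIntegral.integral_of_le (by linarith), ← h0]
      refine setIntegral_eq_integral_of_forall_compl_eq_zero fun s hs' => hzero s fun h2 => hs' ?_
      exact ⟨by linarith [h2.1], by linarith [h2.2]⟩
  refine ⟨fun t => ∫ s in a..t, χ s, ?_, ?_, ?_, hderiv⟩
  · rw [contDiff_infty_iff_deriv, hderiv]
    exact ⟨fun t => (hder t).differentiableAt, hχ⟩
  · exact HasCompactSupport.of_support_subset_isCompact isCompact_Icc
      ((subset_tsupport _).trans hsupp)
  · exact hsupp.trans fun t ht => ⟨by linarith [ht.1], by linarith [ht.2]⟩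

/-- A function with vanishing distributional derivative on an interval is constant. -/
theorem ae_eq_const_of_integral_mul_deriv_eq_zero {f : ℝ → ℝ} {a b : ℝ} (hab : a < b)
    (hf : IntegrableOn f (Ioo a b))
    (h : ∀ η : ℝ → ℝ, ContDiff ℝ ∞ η → HasCompactSupport η → tsupport η ⊆ Ioo a b →
      ∫ t in Ioo a b, f t * deriv η t = 0) :
    ∃ k : ℝ, ∀ᵐ t, t ∈ Ioo a b → f t = k := by
  obtain ⟨β, hβ, hβc, hβs, -, hβ1⟩ := exists_bump_integral_eq_one hab
  have hint : ∀ ψ : ℝ → ℝ, ContDiff ℝ ∞ ψ → HasCompactSupport ψ →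
      IntegrableOn (fun t => f t * ψ t) (Ioo a b) := fun ψ hψ hψc => by
    obtain ⟨C, hC⟩ := hψc.exists_bound_of_continuous hψ.continuous
    exact hf.mul_bdd hψ.continuous.aestronglyMeasurable (ae_of_all _ hC)
  have hset : ∀ ψ : ℝ → ℝ, tsupport ψ ⊆ Ioo a b → ∫ t in Ioo a b, ψ t = ∫ t, ψ t := fun ψ hψ =>
    setIntegral_eq_integral_of_forall_compl_eq_zero fun t ht =>
      image_eq_zero_of_notMem_tsupport fun h' => ht (hψ h')
  set k := ∫ t in Ioo a b, f t * β t with hk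
  refine ⟨k, ?_⟩
  have key : ∀ᵐ t, t ∈ Ioo a b → f t - k = 0 := by
    refine isOpen_Ioo.ae_eq_zero_of_integral_contDiff_smul_eq_zero ?_ ?_
    · exact (hf.sub (integrableOn_const (by simp))).locallyIntegrableOn
    intro ψ hψ hψc hψs
    have hβi := hint β hβ hβc
    have hψi := hint ψ hψ hψc
    set j := ∫ t, ψ t with hj
    have hχs : tsupport (fun t => ψ t - j * β t) ⊆ Ioo a b := by
      refine (tsupport_sub ψ _).trans (union_subset hψs ?_)
      exact (tsupport_mul_subset_right (f := fun _ => j) (g := β)).trans hβs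
    obtain ⟨η, hη, hηc, hηs, hd⟩ := exists_deriv_eq_of_integral_eq_zero
      (χ := fun t => ψ t - j * β t) hab (hψ.sub (contDiff_const.mul hβ))
      (hψc.sub hβc.mul_left) hχs (by
        rw [integral_sub (hψ.continuous.integrable_of_hasCompactSupport hψc)
          ((hβ.continuous.integrable_of_hasCompactSupport hβc).const_mul j),
          integral_const_mul, hβ1, mul_one, sub_self])
    have h0 := h η hη hηc hηs
    have e1 : ∫ t in Ioo a b, f t * ψ t = j * k := by
      rw [hd] at h0
      have : ∀ t, f t * (ψ t - j * β t) = f t * ψ t - j * (f t * β t) := fun t => by ring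
      simp_rw [this] at h0
      rw [integral_sub hψi (hβi.const_mul j), integral_const_mul] at h0
      linarith
    have hψ1 : IntegrableOn ψ (Ioo a b) :=
      (hψ.continuous.integrable_of_hasCompactSupport hψc).integrableOn
    rw [← setIntegral_eq_integral_of_forall_compl_eq_zero (s := Ioo a b) (fun t ht => by
      rw [image_eq_zero_of_notMem_tsupport fun h' => ht (hψs h'), zero_smul])]
    have : ∀ t, ψ t • (f t - k) = f t * ψ t - k * ψ t := fun t => by rw [smul_eq_mul]; ring
    simp_rw [this]
    rw [integral_sub hψi (hψ1.const_mul k), integral_const_mul, e1, hset ψ hψs, ← hj]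
    ring
  filter_upwards [key] with t ht ht'
  linarith [ht ht']

/-- If `H` is the distributional derivative of `K` on an interval, then `K` is almost everywhere a
primitive of `H`. -/
theorem ae_eq_primitive_of_integral_mul_deriv {K H : ℝ → ℝ} {a b c : ℝ} (hab : a < b)
    (hc : c ∈ Icc a b) (hK : IntegrableOn K (Ioo a b)) (hH : IntegrableOn H (Ioo a b))
    (h : ∀ η : ℝ → ℝ, ContDiff ℝ ∞ η → HasCompactSupport η → tsupport η ⊆ Ioo a b →
      ∫ t in Ioo a b, K t * deriv η t = -∫ t in Ioo a b, H t * η t) :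
    ∃ k : ℝ, ∀ᵐ t, t ∈ Ioo a b → K t = k + ∫ s in c..t, H s := by
  have hP := continuousOn_primitive_of_integrableOn hab.le hc hH
  have hPi : IntegrableOn (fun t => ∫ s in c..t, H s) (Ioo a b) :=
    (hP.integrableOn_compact isCompact_Icc).mono_set Ioo_subset_Icc_self
  obtain ⟨k, hk⟩ := ae_eq_const_of_integral_mul_deriv_eq_zero
    (f := fun t => K t - ∫ s in c..t, H s) hab (hK.sub hPi) (fun η hη hηc hηs => by
      have hd : Continuous (deriv η) := hη.continuous_deriv (by simp)
      obtain ⟨C, hC⟩ := hηc.deriv.exists_bound_of_continuous hd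
      simp_rw [sub_mul]
      rw [integral_sub (hK.mul_bdd hd.aestronglyMeasurable (ae_of_all _ hC))
        (hPi.mul_bdd hd.aestronglyMeasurable (ae_of_all _ hC)), h η hη hηc hηs,
        integral_primitive_mul_deriv hab.le hc hH (hη.of_le (by simp))
          (image_eq_zero_of_notMem_tsupport fun h => lt_irrefl _ (hηs h).1)
          (image_eq_zero_of_notMem_tsupport fun h => lt_irrefl _ (hηs h).2), sub_self])
  refine ⟨k, ?_⟩
  filter_upwards [hk] with t ht ht'
  linarith [ht ht']

/-! ### Polar coordinates on the slit disc -/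

/-- The identification of `ℝ × ℝ` with the Euclidean plane. -/
noncomputable def planeEquiv : (ℝ × ℝ) ≃L[ℝ] Plane :=
  (ContinuousLinearEquiv.finTwoArrow ℝ ℝ).symm.trans (EuclideanSpace.equiv (Fin 2) ℝ).symm

theorem planeEquiv_apply (p : ℝ × ℝ) : planeEquiv p = !₂[p.1, p.2] := rfl

theorem planeEquiv_polarCoord_symm (p : ℝ × ℝ) :
    planeEquiv (polarCoord.symm p) = polarPoint p.1 p.2 := rfl

theorem measurePreserving_planeEquiv : MeasurePreserving planeEquiv :=
  (PiLp.volume_preserving_toLp (Fin 2)).comp (volume_preserving_finTwoArrow ℝ).symm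

theorem measurableEmbedding_planeEquiv : MeasurableEmbedding planeEquiv :=
  planeEquiv.toHomeomorph.measurableEmbedding

/-- The domain of the polar coordinates `(R, θ)` of the unit disc, slit along the negative real
axis. -/
def polarRect : Set (ℝ × ℝ) := Ioo 0 1 ×ˢ Ioo (-Real.pi) Real.pi

theorem isOpen_polarRect : IsOpen polarRect := isOpen_Ioo.prod isOpen_Ioo

theorem measurableSet_polarRect : MeasurableSet polarRect := isOpen_polarRect.measurableSet

theorem polarRect_subset_target : polarRect ⊆ polarCoord.target := fun _ h => ⟨h.1.1, h.2⟩

theorem norm_polarPoint (R θ : ℝ) : ‖polarPoint R θ‖ = |R| := by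
  rw [EuclideanSpace.norm_eq, ← Real.sqrt_sq_eq_abs]
  congr 1
  simp only [polarPoint, Fin.sum_univ_two, Real.norm_eq_abs, sq_abs]
  simp only [Matrix.cons_val_zero, Matrix.cons_val_one]
  linear_combination R ^ 2 * Real.sin_sq_add_cos_sq θ

theorem polarPoint_mem_unitDisc {R θ : ℝ} (h : R ∈ Ioo (0 : ℝ) 1) :
    polarPoint R θ ∈ unitDisc \ {0} := by
  have hn := norm_polarPoint R θ
  rw [abs_of_pos h.1] at hn
  refine ⟨by rw [unitDisc, mem_ball_zero_iff, hn]; exact h.2, fun h0 => ?_⟩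
  rw [mem_singleton_iff.1 h0, norm_zero] at hn
  exact h.1.ne hn

theorem contDiffAt_polarCoord {q : ℝ × ℝ} (hq : q ∈ polarCoord.source) :
    ContDiffAt ℝ ∞ polarCoord q := by
  refine ContDiffAt.prodMk (f := fun q : ℝ × ℝ => √(q.1 ^ 2 + q.2 ^ 2))
    (g := fun q : ℝ × ℝ => Complex.arg (Complex.equivRealProd.symm q)) ?_ ?_
  · refine ContDiffAt.sqrt (by fun_prop) ?_
    rcases hq with h | h
    · have : 0 < q.1 := h
      positivity
    · have : q.2 ≠ 0 := h
      positivity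
  · have h1 : Complex.equivRealProdCLM.symm q ∈ Complex.slitPlane := hq
    have h2 : ContDiffAt ℝ ∞ (fun q => (Complex.log (Complex.equivRealProdCLM.symm q)).im) q := by
      have h3 : ContDiffAt ℝ ∞ Complex.log (Complex.equivRealProdCLM.symm q) :=
        (Complex.contDiffAt_log h1).restrict_scalars ℝ
      exact Complex.imCLM.contDiff.contDiffAt.comp q
        (h3.comp q Complex.equivRealProdCLM.symm.contDiff.contDiffAt)
    simp only [Complex.log_im] at h2
    exact h2

/-- Integration in polar coordinates over the unit disc. -/
theorem setIntegral_unitDisc_eq_polar {E : Type*} [NormedAddCommGroup E] [NormedSpace ℝ E]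
    (f : Plane → E) :
    ∫ x in unitDisc, f x = ∫ p in polarRect, p.1 • f (polarPoint p.1 p.2) := by
  have hB : MeasurableSet unitDisc := Metric.isOpen_ball.measurableSet
  rw [← integral_indicator hB,
    ← measurePreserving_planeEquiv.integral_comp measurableEmbedding_planeEquiv,
    ← integral_comp_polarCoord_symm, ← integral_indicator polarCoord.open_target.measurableSet,
    ← integral_indicator measurableSet_polarRect]
  congr 1
  ext p
  simp only [planeEquiv_polarCoord_symm]
  by_cases h : p ∈ polarRect
  · rw [indicator_of_mem (polarRect_subset_target h), indicator_of_mem h,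
      indicator_of_mem (polarPoint_mem_unitDisc h.1).1]
  · rw [indicator_of_notMem h]
    by_cases ht : p ∈ polarCoord.target
    · rw [indicator_of_mem ht, indicator_of_notMem, smul_zero]
      intro hB
      rw [unitDisc, mem_ball_zero_iff, norm_polarPoint, abs_of_pos ht.1] at hB
      exact h ⟨⟨ht.1, hB⟩, ht.2⟩
    · rw [indicator_of_notMem ht]

/-- Integrability on a disc of radius `r ≤ 1` passes to polar coordinates. -/
theorem integrableOn_polar {E : Type*} [NormedAddCommGroup E] [NormedSpace ℝ E]
    {f : Plane → E} {r : ℝ} (hf : IntegrableOn f (Metric.ball 0 r)) :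
    IntegrableOn (fun p : ℝ × ℝ => p.1 • f (polarPoint p.1 p.2))
      (Ioo 0 r ×ˢ Ioo (-Real.pi) Real.pi) := by
  have hs : MeasurableSet (Ioo 0 r ×ˢ Ioo (-Real.pi) Real.pi) :=
    measurableSet_Ioo.prod measurableSet_Ioo
  have hsub : Ioo 0 r ×ˢ Ioo (-Real.pi) Real.pi ⊆ polarCoord.target := fun p h => ⟨h.1.1, h.2⟩
  have h1 := (integrableOn_image_iff_integrableOn_abs_det_fderiv_smul volume hs
    (fun p _ => (hasFDerivAt_polarCoord_symm p).hasFDerivWithinAt)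
    (polarCoord.symm.injOn.mono hsub) (fun q => f (planeEquiv q))).1 ?_
  · refine h1.congr_fun (fun p hp => ?_) hs
    simp only [det_fderivPolarCoordSymm, planeEquiv_polarCoord_symm]
    rw [abs_of_pos hp.1.1]
  · have h2 := (measurePreserving_planeEquiv.integrableOn_comp_preimage
      measurableEmbedding_planeEquiv).2 hf
    refine h2.mono_set ?_
    rintro _ ⟨p, hp, rfl⟩
    rw [mem_preimage, planeEquiv_polarCoord_symm, mem_ball_zero_iff, norm_polarPoint,
      abs_of_pos hp.1.1]
    exact hp.1.2

/-- Null sets of the disc are the null sets of its polar coordinates. -/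
theorem ae_unitDisc_iff_polar {P : Plane → Prop} :
    (∀ᵐ x, x ∈ unitDisc → P x) ↔ ∀ᵐ p : ℝ × ℝ, p ∈ polarRect → P (polarPoint p.1 p.2) := by
  have h0 : (∀ᵐ x, x ∈ unitDisc → P x) ↔
      ∀ᵐ q : ℝ × ℝ, planeEquiv q ∈ unitDisc → P (planeEquiv q) := by
    rw [← measurePreserving_planeEquiv.map_eq, measurableEmbedding_planeEquiv.ae_map_iff]
  rw [h0]
  have hsrc : ∀ᵐ q : ℝ × ℝ, q ∈ polarCoord.source := by
    filter_upwards [polarCoord_source_ae_eq_univ.mem_iff] with q hq using hq.2 (mem_univ q)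
  constructor
  · intro h
    rw [ae_iff] at h ⊢
    set N := {q : ℝ × ℝ | ¬(planeEquiv q ∈ unitDisc → P (planeEquiv q))}
    have hN : volume (N ∩ polarCoord.source) = 0 := measure_inter_null_of_null_left _ h
    refine measure_mono_null ?_ (addHaar_image_eq_zero_of_differentiableOn_of_addHaar_eq_zero
      (f := polarCoord) volume (fun q hq => ((contDiffAt_polarCoord hq.2).differentiableAt
        (by simp)).differentiableWithinAt) hN)
    intro p hp
    obtain ⟨hp1, hp2⟩ := Classical.not_imp.1 hp
    have ht := polarRect_subset_target hp1
    refine ⟨polarCoord.symm p, ⟨?_, polarCoord.map_target ht⟩, polarCoord.right_inv ht⟩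
    exact Classical.not_imp.2 ⟨(polarPoint_mem_unitDisc hp1.1).1, hp2⟩
  · intro h
    have h' : ∀ᵐ q : ℝ × ℝ, q ∈ polarCoord.source → planeEquiv q ∈ unitDisc → P (planeEquiv q) := by
      rw [ae_iff] at h ⊢
      refine measure_mono_null ?_ (addHaar_image_eq_zero_of_differentiableOn_of_addHaar_eq_zero
        (f := polarCoord.symm) volume (fun p _ =>
          (hasFDerivAt_polarCoord_symm p).differentiableAt.differentiableWithinAt) h)
      intro q hq
      obtain ⟨hq1, hq2⟩ := Classical.not_imp.1 hq
      obtain ⟨hq2, hq3⟩ := Classical.not_imp.1 hq2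
      have hl := polarCoord.left_inv hq1
      have ht := polarCoord.map_source hq1
      refine ⟨polarCoord q, Classical.not_imp.2 ⟨⟨⟨ht.1, ?_⟩, ht.2⟩, ?_⟩, hl⟩
      · rw [← hl, planeEquiv_polarCoord_symm, unitDisc, mem_ball_zero_iff, norm_polarPoint,
          abs_of_pos ht.1] at hq2
        exact hq2
      · rw [← planeEquiv_polarCoord_symm, hl]
        exact hq3
    filter_upwards [h', hsrc] with q h1 h2 using h1 h2

/-- The test function on the plane which is `ψ` in polar coordinates. No case distinction is needed
on the slit: there `polarCoord` takes values outside `polarRect`, where `ψ` vanishes. -/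
noncomputable def polarTest (ψ : ℝ × ℝ → ℝ) (x : Plane) : ℝ := ψ (polarCoord (planeEquiv.symm x))

theorem polarTest_polarPoint (ψ : ℝ × ℝ → ℝ) {p : ℝ × ℝ} (hp : p ∈ polarRect) :
    polarTest ψ (polarPoint p.1 p.2) = ψ p := by
  rw [polarTest, ← planeEquiv_polarCoord_symm, ContinuousLinearEquiv.symm_apply_apply,
    polarCoord.right_inv (polarRect_subset_target hp)]

theorem mem_source_of_polarCoord_mem_target {q : ℝ × ℝ} (h : polarCoord q ∈ polarCoord.target) :
    q ∈ polarCoord.source := by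
  have h1 : 0 < √(q.1 ^ 2 + q.2 ^ 2) := h.1
  have h2 : Complex.arg (Complex.equivRealProd.symm q) < Real.pi := h.2.2
  have h3 := Complex.arg_lt_pi_iff.1 h2
  by_contra hcon
  have h4 : q.1 ≤ 0 ∧ q.2 = 0 := by
    simpa [polarCoord_source, not_or] using! hcon
  rcases h3 with h3 | h3
  · have h5 : q.1 = 0 := le_antisymm h4.1 h3
    simp [h5, h4.2] at h1
  · exact h3 h4.2

theorem polarTest_support_subset {ψ : ℝ × ℝ → ℝ} (hs : tsupport ψ ⊆ polarRect) :
    Function.support (polarTest ψ) ⊆ (fun p : ℝ × ℝ => polarPoint p.1 p.2) '' tsupport ψ := by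
  intro x hx
  have h1 : polarCoord (planeEquiv.symm x) ∈ tsupport ψ := subset_tsupport _ hx
  have h2 := mem_source_of_polarCoord_mem_target (polarRect_subset_target (hs h1))
  refine ⟨_, h1, ?_⟩
  simp only [← planeEquiv_polarCoord_symm]
  rw [polarCoord.left_inv h2, ContinuousLinearEquiv.apply_symm_apply]

theorem continuous_polarPoint : Continuous (fun p : ℝ × ℝ => polarPoint p.1 p.2) :=
  planeEquiv.continuous.comp continuous_polarCoord_symm

theorem polarTest_tsupport_subset {ψ : ℝ × ℝ → ℝ} (hc : HasCompactSupport ψ)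
    (hs : tsupport ψ ⊆ polarRect) :
    tsupport (polarTest ψ) ⊆ (fun p : ℝ × ℝ => polarPoint p.1 p.2) '' tsupport ψ :=
  closure_minimal (polarTest_support_subset hs) (hc.image continuous_polarPoint).isClosed

theorem polarTest_tsupport_subset_unitDisc {ψ : ℝ × ℝ → ℝ} (hc : HasCompactSupport ψ)
    (hs : tsupport ψ ⊆ polarRect) : tsupport (polarTest ψ) ⊆ unitDisc := by
  refine (polarTest_tsupport_subset hc hs).trans ?_
  rintro _ ⟨p, hp, rfl⟩
  exact (polarPoint_mem_unitDisc (hs hp).1).1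

theorem polarTest_hasCompactSupport {ψ : ℝ × ℝ → ℝ} (hc : HasCompactSupport ψ)
    (hs : tsupport ψ ⊆ polarRect) : HasCompactSupport (polarTest ψ) :=
  HasCompactSupport.of_support_subset_isCompact (hc.image continuous_polarPoint)
    (polarTest_support_subset hs)

theorem polarTest_contDiff {ψ : ℝ × ℝ → ℝ} (hψ : ContDiff ℝ ∞ ψ) (hc : HasCompactSupport ψ)
    (hs : tsupport ψ ⊆ polarRect) : ContDiff ℝ ∞ (polarTest ψ) := by
  refine contDiff_iff_contDiffAt.2 fun x => ?_
  by_cases hx : planeEquiv.symm x ∈ polarCoord.source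
  · exact hψ.contDiffAt.comp x ((contDiffAt_polarCoord hx).comp x
      planeEquiv.symm.contDiff.contDiffAt)
  · have h1 : x ∉ tsupport (polarTest ψ) := by
      intro h
      obtain ⟨p, hp, rfl⟩ := polarTest_tsupport_subset hc hs h
      apply hx
      simp only [← planeEquiv_polarCoord_symm, ContinuousLinearEquiv.symm_apply_apply]
      exact polarCoord.map_target (polarRect_subset_target (hs hp))
    exact contDiffAt_const.congr_of_eventuallyEq (notMem_tsupport_iff_eventuallyEq.1 h1)

theorem hasDerivAt_polarPoint_radius (R θ : ℝ) :
    HasDerivAt (fun R => polarPoint R θ) (polarPoint 1 θ) R := by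
  have h : HasDerivAt (fun R : ℝ => planeEquiv (R * Real.cos θ, R * Real.sin θ))
      (planeEquiv (1 * Real.cos θ, 1 * Real.sin θ)) R :=
    planeEquiv.hasFDerivAt.comp_hasDerivAt R
      (((hasDerivAt_id R).mul_const _).prodMk ((hasDerivAt_id R).mul_const _))
  exact h

theorem hasDerivAt_polarPoint_angle (R θ : ℝ) :
    HasDerivAt (fun θ => polarPoint R θ) !₂[R * -Real.sin θ, R * Real.cos θ] θ := by
  have h : HasDerivAt (fun θ : ℝ => planeEquiv (R * Real.cos θ, R * Real.sin θ))
      (planeEquiv (R * -Real.sin θ, R * Real.cos θ)) θ :=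
    planeEquiv.hasFDerivAt.comp_hasDerivAt θ
      (((Real.hasDerivAt_cos θ).const_mul R).prodMk ((Real.hasDerivAt_sin θ).const_mul R))
  exact h

theorem vec_eq_smul_coordVec (a b : ℝ) :
    (!₂[a, b] : Plane) = a • coordVec 0 + b • coordVec 1 := by
  ext i
  fin_cases i <;> simp [coordVec]

/-- The chain rule for a test function in polar coordinates. -/
theorem fderiv_polarTest {ψ : ℝ × ℝ → ℝ} (hψ : ContDiff ℝ ∞ ψ) (hc : HasCompactSupport ψ)
    (hs : tsupport ψ ⊆ polarRect) {p : ℝ × ℝ} (hp : p ∈ polarRect) :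
    p.1 * fderiv ℝ (polarTest ψ) (polarPoint p.1 p.2) (coordVec 0) =
        p.1 * Real.cos p.2 * fderiv ℝ ψ p (1, 0) - Real.sin p.2 * fderiv ℝ ψ p (0, 1) ∧
      p.1 * fderiv ℝ (polarTest ψ) (polarPoint p.1 p.2) (coordVec 1) =
        p.1 * Real.sin p.2 * fderiv ℝ ψ p (1, 0) + Real.cos p.2 * fderiv ℝ ψ p (0, 1) := by
  have hd : HasFDerivAt (polarTest ψ) (fderiv ℝ (polarTest ψ) (polarPoint p.1 p.2))
      (polarPoint p.1 p.2) :=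
    ((polarTest_contDiff hψ hc hs).differentiable (by simp) _).hasFDerivAt
  have hψd : HasFDerivAt ψ (fderiv ℝ ψ p) p := (hψ.differentiable (by simp) p).hasFDerivAt
  have hnear : ∀ᶠ q in 𝓝 p, polarTest ψ (polarPoint q.1 q.2) = ψ q := by
    filter_upwards [isOpen_polarRect.mem_nhds hp] with q hq using polarTest_polarPoint ψ hq
  have h1 : fderiv ℝ (polarTest ψ) (polarPoint p.1 p.2) (polarPoint 1 p.2) =
      fderiv ℝ ψ p (1, 0) := by
    have ha : HasDerivAt (fun R : ℝ => (R, p.2)) (1, 0) p.1 :=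
      (hasDerivAt_id _).prodMk (hasDerivAt_const _ _)
    have hb := hψd.comp_hasDerivAt p.1 ha
    have hc' := hd.comp_hasDerivAt p.1 (hasDerivAt_polarPoint_radius p.1 p.2)
    refine (hc'.congr_of_eventuallyEq ?_).unique hb
    filter_upwards [ha.continuousAt.eventually hnear] with R hR using hR.symm
  have h2 : fderiv ℝ (polarTest ψ) (polarPoint p.1 p.2)
      !₂[p.1 * -Real.sin p.2, p.1 * Real.cos p.2] = fderiv ℝ ψ p (0, 1) := by
    have ha : HasDerivAt (fun θ : ℝ => (p.1, θ)) (0, 1) p.2 :=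
      (hasDerivAt_const _ _).prodMk (hasDerivAt_id _)
    have hb := hψd.comp_hasDerivAt p.2 ha
    have hc' := hd.comp_hasDerivAt p.2 (hasDerivAt_polarPoint_angle p.1 p.2)
    refine (hc'.congr_of_eventuallyEq ?_).unique hb
    filter_upwards [ha.continuousAt.eventually hnear] with R hR using hR.symm
  have hv : polarPoint 1 p.2 = Real.cos p.2 • coordVec 0 + Real.sin p.2 • coordVec 1 := by
    rw [polarPoint, vec_eq_smul_coordVec, one_mul, one_mul]
  rw [hv, map_add, map_smul, map_smul] at h1
  rw [vec_eq_smul_coordVec, map_add, map_smul, map_smul] at h2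
  simp only [smul_eq_mul] at h1 h2
  have hcs := Real.sin_sq_add_cos_sq p.2
  set D := fderiv ℝ (polarTest ψ) (polarPoint p.1 p.2)
  rw [← h1, ← h2]
  constructor
  · linear_combination -p.1 * D (coordVec 0) * hcs
  · linear_combination -p.1 * D (coordVec 1) * hcs

/-! ### Test functions on the polar rectangle -/

/-- Test functions on `polarRect`: smooth with compact support in it. -/
structure IsPolarTest (ψ : ℝ × ℝ → ℝ) : Prop where
  contDiff : ContDiff ℝ ∞ ψ
  hasCompactSupport : HasCompactSupport ψ
  tsupport_subset : tsupport ψ ⊆ polarRect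

namespace IsPolarTest

theorem mul {ψ c : ℝ × ℝ → ℝ} (hψ : IsPolarTest ψ) (hc : ContDiff ℝ ∞ c) :
    IsPolarTest (fun p => ψ p * c p) :=
  ⟨hψ.contDiff.mul hc, hψ.hasCompactSupport.mul_right,
    (tsupport_mul_subset_left (f := ψ) (g := c)).trans hψ.tsupport_subset⟩

theorem prod {β η : ℝ → ℝ} (hβ : ContDiff ℝ ∞ β) (hβc : HasCompactSupport β)
    (hβs : tsupport β ⊆ Ioo 0 1) (hη : ContDiff ℝ ∞ η) (hηc : HasCompactSupport η)
    (hηs : tsupport η ⊆ Ioo (-Real.pi) Real.pi) : IsPolarTest (fun p => β p.1 * η p.2) := by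
  have hsub : Function.support (fun p : ℝ × ℝ => β p.1 * η p.2) ⊆ tsupport β ×ˢ tsupport η :=
    fun p hp => ⟨subset_tsupport _ (left_ne_zero_of_mul hp),
      subset_tsupport _ (right_ne_zero_of_mul hp)⟩
  exact ⟨(hβ.comp contDiff_fst).mul (hη.comp contDiff_snd),
    HasCompactSupport.of_support_subset_isCompact (hβc.prod hηc) hsub,
    (closure_minimal hsub (hβc.prod hηc).isClosed).trans (prod_mono hβs hηs)⟩

variable {ψ : ℝ × ℝ → ℝ}

theorem eq_zero (hψ : IsPolarTest ψ) {p : ℝ × ℝ} (hp : p ∉ polarRect) : ψ p = 0 :=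
  image_eq_zero_of_notMem_tsupport fun h => hp (hψ.tsupport_subset h)

theorem continuous_fderiv (hψ : IsPolarTest ψ) (v : ℝ × ℝ) :
    Continuous (fun p => fderiv ℝ ψ p v) :=
  (hψ.contDiff.continuous_fderiv (by simp)).clm_apply continuous_const

theorem hasDerivAt_fst (hψ : IsPolarTest ψ) (R θ : ℝ) :
    HasDerivAt (fun R => ψ (R, θ)) (fderiv ℝ ψ (R, θ) (1, 0)) R :=
  (hψ.contDiff.differentiable (by simp) _).hasFDerivAt.comp_hasDerivAt R
    ((hasDerivAt_id R).prodMk (hasDerivAt_const R θ))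

theorem hasDerivAt_snd (hψ : IsPolarTest ψ) (R θ : ℝ) :
    HasDerivAt (fun θ => ψ (R, θ)) (fderiv ℝ ψ (R, θ) (0, 1)) θ :=
  (hψ.contDiff.differentiable (by simp) _).hasFDerivAt.comp_hasDerivAt θ
    ((hasDerivAt_const θ R).prodMk (hasDerivAt_id θ))

theorem fderiv_mul_comp_snd (hψ : IsPolarTest ψ) {c : ℝ → ℝ} {c' : ℝ} {p : ℝ × ℝ}
    (hc : HasDerivAt c c' p.2) (v : ℝ × ℝ) :
    fderiv ℝ (fun p => ψ p * c p.2) p v = fderiv ℝ ψ p v * c p.2 + ψ p * (c' * v.2) := by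
  have h1 := (hψ.contDiff.differentiable (by simp) p).hasFDerivAt
  have h2 := hc.comp_hasFDerivAt p (hasFDerivAt_snd (𝕜 := ℝ) (p := p))
  have h3 : HasFDerivAt (fun p => ψ p * c p.2) _ p := h1.mul h2
  rw [h3.fderiv]
  simp
  ring

end IsPolarTest

theorem integrableOn_polarRect_mul {f c : ℝ × ℝ → ℝ} (hf : IntegrableOn f polarRect)
    (hc : Continuous c) : IntegrableOn (fun p => f p * c p) polarRect := by
  obtain ⟨C, hC⟩ := (isCompact_Icc.prod isCompact_Icc :
    IsCompact (Icc (0 : ℝ) 1 ×ˢ Icc (-Real.pi) Real.pi)).exists_bound_of_continuousOn hc.continuousOn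
  refine hf.mul_bdd (c := C) hc.aestronglyMeasurable ?_
  refine (ae_restrict_iff' measurableSet_polarRect).2 (ae_of_all _ fun p hp => hC p ?_)
  exact ⟨Ioo_subset_Icc_self hp.1, Ioo_subset_Icc_self hp.2⟩

theorem ae_eq_zero_of_integral_mul_polarTest {f : ℝ × ℝ → ℝ} (hf : IntegrableOn f polarRect)
    (h : ∀ ψ, IsPolarTest ψ → ∫ p in polarRect, f p * ψ p = 0) :
    ∀ᵐ p, p ∈ polarRect → f p = 0 := by
  refine isOpen_polarRect.ae_eq_zero_of_integral_contDiff_smul_eq_zero hf.locallyIntegrableOn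
    fun ψ hψ hc hs => ?_
  rw [← h ψ ⟨hψ, hc, hs⟩, ← setIntegral_eq_integral_of_forall_compl_eq_zero (s := polarRect)
    (fun p hp => by rw [image_eq_zero_of_notMem_tsupport fun h' => hp (hs h'), zero_smul])]
  simp_rw [smul_eq_mul, mul_comm]

theorem volume_restrict_polarRect : volume.restrict polarRect =
    (volume.restrict (Ioo (0 : ℝ) 1)).prod (volume.restrict (Ioo (-Real.pi) Real.pi)) := by
  rw [polarRect, Measure.prod_restrict]; rfl

theorem setIntegral_polarRect {f : ℝ × ℝ → ℝ} (hf : IntegrableOn f polarRect) :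
    ∫ p in polarRect, f p = ∫ R in Ioo 0 1, ∫ θ in Ioo (-Real.pi) Real.pi, f (R, θ) := by
  rw [IntegrableOn, volume_restrict_polarRect] at hf
  rw [volume_restrict_polarRect, integral_prod _ hf]

theorem setIntegral_polarRect_symm {f : ℝ × ℝ → ℝ} (hf : IntegrableOn f polarRect) :
    ∫ p in polarRect, f p = ∫ θ in Ioo (-Real.pi) Real.pi, ∫ R in Ioo 0 1, f (R, θ) := by
  rw [IntegrableOn, volume_restrict_polarRect] at hf
  rw [volume_restrict_polarRect, integral_prod_symm _ hf]

theorem integrableOn_polarRect_comp_snd {g : ℝ → ℝ}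
    (hg : IntegrableOn g (Ioo (-Real.pi) Real.pi)) :
    IntegrableOn (fun p : ℝ × ℝ => g p.2) polarRect := by
  rw [IntegrableOn, volume_restrict_polarRect]
  exact Integrable.comp_snd hg _

/-- A function of the angle is integrable if its product with a positive function of the radius
is. -/
theorem integrableOn_of_integrableOn_polarRect {g : ℝ → ℝ} {w : ℝ → ℝ}
    (hw : ∀ R ∈ Ioo (0 : ℝ) 1, w R ≠ 0)
    (h : IntegrableOn (fun p : ℝ × ℝ => w p.1 * g p.2) polarRect) :
    IntegrableOn g (Ioo (-Real.pi) Real.pi) := by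
  rw [IntegrableOn, volume_restrict_polarRect] at h
  have h1 := h.prod_right_ae
  have hne : (ae (volume.restrict (Ioo (0 : ℝ) 1))).NeBot := by
    rw [ae_neBot, Ne, Measure.restrict_eq_zero]
    simp
  obtain ⟨R, hR, hRm⟩ := (h1.and (ae_restrict_mem measurableSet_Ioo)).exists
  exact (integrable_const_mul_iff (isUnit_iff_ne_zero.2 (hw R hRm)) g).1 hR

/-- Integration by parts in the radius, with the weight `R ^ 2`. -/
theorem setIntegral_polarRect_radial {g : ℝ → ℝ} (hg : IntegrableOn g (Ioo (-Real.pi) Real.pi))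
    {ψ : ℝ × ℝ → ℝ} (hψ : IsPolarTest ψ) :
    ∫ p in polarRect, g p.2 * (p.1 * (p.1 * fderiv ℝ ψ p (1, 0) + 2 * ψ p)) = 0 := by
  have hi : IntegrableOn (fun p : ℝ × ℝ => g p.2 *
      (p.1 * (p.1 * fderiv ℝ ψ p (1, 0) + 2 * ψ p))) polarRect := by
    refine integrableOn_polarRect_mul (integrableOn_polarRect_comp_snd hg) ?_
    have := hψ.continuous_fderiv (1, 0)
    have := hψ.contDiff.continuous
    fun_prop
  rw [setIntegral_polarRect_symm hi]
  refine integral_eq_zero_of_ae (ae_of_all _ fun θ => ?_)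
  simp only [Pi.zero_apply]
  rw [integral_const_mul, ← integral_Ioc_eq_integral_Ioo,
    ← intervalIntegral.integral_of_le zero_le_one]
  have hd : ∀ R ∈ uIcc (0 : ℝ) 1, HasDerivAt (fun R => R ^ 2 * ψ (R, θ))
      (R * (R * fderiv ℝ ψ (R, θ) (1, 0) + 2 * ψ (R, θ))) R := fun R _ => by
    refine ((hasDerivAt_pow 2 R).mul (hψ.hasDerivAt_fst R θ)).congr_deriv ?_
    push_cast
    ring
  rw [intervalIntegral.integral_eq_sub_of_hasDerivAt hd]
  · rw [hψ.eq_zero (p := (1, θ)) fun h => lt_irrefl _ h.1.2]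
    simp
  · have h1 := hψ.continuous_fderiv (1, 0)
    have h2 := hψ.contDiff.continuous
    exact Continuous.intervalIntegrable (by fun_prop) _ _

/-- Integration by parts in the angle. -/
theorem setIntegral_polarRect_angular {ξ : ℝ → ℝ} (hξ : IntegrableOn ξ (Ioo (-Real.pi) Real.pi))
    (k : ℝ) {ψ : ℝ × ℝ → ℝ} (hψ : IsPolarTest ψ) :
    ∫ p in polarRect, (k + ∫ s in (0 : ℝ)..p.2, ξ s) * (p.1 * fderiv ℝ ψ p (0, 1)) =
      -∫ p in polarRect, ξ p.2 * (p.1 * ψ p) := by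
  have hpi := Real.pi_pos
  have hP : ContinuousOn (fun t => ∫ s in (0 : ℝ)..t, ξ s) (Icc (-Real.pi) Real.pi) :=
    continuousOn_primitive_of_integrableOn (by linarith) (by constructor <;> linarith) hξ
  have hPi : IntegrableOn (fun t => ∫ s in (0 : ℝ)..t, ξ s) (Ioo (-Real.pi) Real.pi) :=
    (hP.integrableOn_compact isCompact_Icc).mono_set Ioo_subset_Icc_self
  have c1 := hψ.continuous_fderiv (0, 1)
  have c2 := hψ.contDiff.continuous
  have hi1 : IntegrableOn (fun p : ℝ × ℝ => (k + ∫ s in (0 : ℝ)..p.2, ξ s) *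
      (p.1 * fderiv ℝ ψ p (0, 1))) polarRect :=
    integrableOn_polarRect_mul (integrableOn_polarRect_comp_snd
      ((integrableOn_const (by simp)).add hPi)) (by fun_prop)
  have hi2 : IntegrableOn (fun p : ℝ × ℝ => ξ p.2 * (p.1 * ψ p)) polarRect :=
    integrableOn_polarRect_mul (integrableOn_polarRect_comp_snd hξ) (by fun_prop)
  rw [setIntegral_polarRect hi1, setIntegral_polarRect hi2, ← integral_neg]
  refine integral_congr_ae (ae_of_all _ fun R => ?_)
  simp only
  have hη : ContDiff ℝ 1 (fun θ => ψ (R, θ)) :=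
    (hψ.contDiff.of_le (by simp)).comp (contDiff_const.prodMk contDiff_id)
  have hd : deriv (fun θ => ψ (R, θ)) = fun θ => fderiv ℝ ψ (R, θ) (0, 1) :=
    funext fun θ => (hψ.hasDerivAt_snd R θ).deriv
  have ha : ψ (R, -Real.pi) = 0 := hψ.eq_zero fun h => lt_irrefl _ h.2.1
  have hb : ψ (R, Real.pi) = 0 := hψ.eq_zero fun h => lt_irrefl _ h.2.2
  have key := integral_primitive_mul_deriv (c := 0) (by linarith)
    (by constructor <;> linarith) hξ hη ha hb
  rw [hd] at key
  have c3 : Continuous fun θ => fderiv ℝ ψ (R, θ) (0, 1) := by fun_prop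
  have hk : ∫ θ in Ioo (-Real.pi) Real.pi, fderiv ℝ ψ (R, θ) (0, 1) = 0 := by
    rw [← integral_Ioc_eq_integral_Ioo, ← intervalIntegral.integral_of_le (by linarith),
      intervalIntegral.integral_eq_sub_of_hasDerivAt (fun θ _ => hψ.hasDerivAt_snd R θ)
        (c3.intervalIntegrable _ _), ha, hb, sub_zero]
  have e1 : ∀ θ, (k + ∫ s in (0 : ℝ)..θ, ξ s) * (R * fderiv ℝ ψ (R, θ) (0, 1)) =
      R * k * fderiv ℝ ψ (R, θ) (0, 1) +
        R * ((∫ s in (0 : ℝ)..θ, ξ s) * fderiv ℝ ψ (R, θ) (0, 1)) := fun θ => by ring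
  have e2 : ∀ θ, ξ θ * (R * ψ (R, θ)) = R * (ξ θ * ψ (R, θ)) := fun θ => by ring
  simp_rw [e1, e2]
  have c4 : IntegrableOn (fun θ => fderiv ℝ ψ (R, θ) (0, 1)) (Ioo (-Real.pi) Real.pi) :=
    (c3.continuousOn.integrableOn_compact isCompact_Icc).mono_set Ioo_subset_Icc_self
  have c5 : IntegrableOn (fun θ => (∫ s in (0 : ℝ)..θ, ξ s) * fderiv ℝ ψ (R, θ) (0, 1))
      (Ioo (-Real.pi) Real.pi) :=
    ((hP.mul c3.continuousOn).integrableOn_compact isCompact_Icc).mono_set Ioo_subset_Icc_self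
  rw [integral_add (c4.const_mul _) (c5.const_mul _), integral_const_mul, integral_const_mul, hk,
    key, integral_const_mul]
  ring

/-! ### The weak gradient of a one-homogeneous function -/

/-- The weak gradient of a scalar one-homogeneous function `u = R g(θ)`, in polar coordinates: its
radial component is `g(θ)`, its angular component is a function `ξ(θ)` of the angle alone, and `g`
is a primitive of `ξ`. -/
theorem exists_polar_gradient {u : Plane → ℝ} {D : Fin 2 → Plane → ℝ} {g : ℝ → ℝ}
    (hu : IntegrableOn u unitDisc) (hD : ∀ i, IntegrableOn (D i) unitDisc)
    (hg : ∀ p ∈ polarRect, u (polarPoint p.1 p.2) = p.1 * g p.2)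
    (hw : ∀ φ : Plane → ℝ, ContDiff ℝ ∞ φ → HasCompactSupport φ → tsupport φ ⊆ unitDisc →
      ∀ i, ∫ x in unitDisc, u x * fderiv ℝ φ x (coordVec i) = -∫ x in unitDisc, D i x * φ x) :
    ∃ (k : ℝ) (ξ : ℝ → ℝ), IntegrableOn ξ (Ioo (-Real.pi) Real.pi) ∧
      (∀ᵐ θ, θ ∈ Ioo (-Real.pi) Real.pi → g θ = k + ∫ s in (0 : ℝ)..θ, ξ s) ∧
      ∀ᵐ p : ℝ × ℝ, p ∈ polarRect →
        D 0 (polarPoint p.1 p.2) = g p.2 * Real.cos p.2 - ξ p.2 * Real.sin p.2 ∧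
        D 1 (polarPoint p.1 p.2) = g p.2 * Real.sin p.2 + ξ p.2 * Real.cos p.2 := by
  have hE : ∀ i, IntegrableOn (fun p : ℝ × ℝ => p.1 * D i (polarPoint p.1 p.2)) polarRect :=
    fun i => integrableOn_polar (hD i)
  have hgi : IntegrableOn g (Ioo (-Real.pi) Real.pi) := by
    refine integrableOn_of_integrableOn_polarRect (w := fun R => R * R)
      (fun R hR => (mul_pos hR.1 hR.1).ne') ?_
    refine (integrableOn_polar hu).congr_fun (fun p hp => ?_) measurableSet_polarRect
    simp only [smul_eq_mul, hg p hp]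
    ring
  -- the weak formulation of the two Cartesian components of the gradient
  have hw0 : ∀ ψ, IsPolarTest ψ → ∫ p in polarRect, g p.2 * (p.1 *
      (p.1 * Real.cos p.2 * fderiv ℝ ψ p (1, 0) - Real.sin p.2 * fderiv ℝ ψ p (0, 1))) =
      -∫ p in polarRect, p.1 * D 0 (polarPoint p.1 p.2) * ψ p := fun ψ hψ => by
    have h := hw _ (polarTest_contDiff hψ.1 hψ.2 hψ.3) (polarTest_hasCompactSupport hψ.2 hψ.3)
      (polarTest_tsupport_subset_unitDisc hψ.2 hψ.3) 0
    rw [setIntegral_unitDisc_eq_polar, setIntegral_unitDisc_eq_polar] at h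
    convert h using 1
    · refine setIntegral_congr_fun measurableSet_polarRect fun p hp => ?_
      simp only [smul_eq_mul]
      rw [← (fderiv_polarTest hψ.1 hψ.2 hψ.3 hp).1, hg p hp]
      ring
    · congr 1
      refine setIntegral_congr_fun measurableSet_polarRect fun p hp => ?_
      simp only [smul_eq_mul]
      rw [polarTest_polarPoint ψ hp]
      ring
  have hw1 : ∀ ψ, IsPolarTest ψ → ∫ p in polarRect, g p.2 * (p.1 *
      (p.1 * Real.sin p.2 * fderiv ℝ ψ p (1, 0) + Real.cos p.2 * fderiv ℝ ψ p (0, 1))) =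
      -∫ p in polarRect, p.1 * D 1 (polarPoint p.1 p.2) * ψ p := fun ψ hψ => by
    have h := hw _ (polarTest_contDiff hψ.1 hψ.2 hψ.3) (polarTest_hasCompactSupport hψ.2 hψ.3)
      (polarTest_tsupport_subset_unitDisc hψ.2 hψ.3) 1
    rw [setIntegral_unitDisc_eq_polar, setIntegral_unitDisc_eq_polar] at h
    convert h using 1
    · refine setIntegral_congr_fun measurableSet_polarRect fun p hp => ?_
      simp only [smul_eq_mul]
      rw [← (fderiv_polarTest hψ.1 hψ.2 hψ.3 hp).2, hg p hp]
      ring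
    · congr 1
      refine setIntegral_congr_fun measurableSet_polarRect fun p hp => ?_
      simp only [smul_eq_mul]
      rw [polarTest_polarPoint ψ hp]
      ring
  set E₀ : ℝ × ℝ → ℝ := fun p => p.1 * D 0 (polarPoint p.1 p.2) with hE₀
  set E₁ : ℝ × ℝ → ℝ := fun p => p.1 * D 1 (polarPoint p.1 p.2) with hE₁
  have iE₀ : IntegrableOn E₀ polarRect := hE 0
  have iE₁ : IntegrableOn E₁ polarRect := hE 1
  have hg2 := integrableOn_polarRect_comp_snd hgi
  have hcos : ContDiff ℝ ∞ fun p : ℝ × ℝ => Real.cos p.2 := Real.contDiff_cos.comp contDiff_snd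
  have hsin : ContDiff ℝ ∞ fun p : ℝ × ℝ => Real.sin p.2 := Real.contDiff_sin.comp contDiff_snd
  -- testing with `ψ cos θ` and `ψ sin θ` isolates the polar components
  have hrad : ∀ ψ, IsPolarTest ψ →
      ∫ p in polarRect, g p.2 * (p.1 * (p.1 * fderiv ℝ ψ p (1, 0) + ψ p)) =
      -∫ p in polarRect, (E₀ p * Real.cos p.2 + E₁ p * Real.sin p.2) * ψ p := fun ψ hψ => by
    have h0 := hw0 _ (hψ.mul hcos)
    have h1 := hw1 _ (hψ.mul hsin)
    have c0 := (hψ.mul hcos).continuous_fderiv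
    have c1 := (hψ.mul hsin).continuous_fderiv
    have c2 := hψ.contDiff.continuous
    have s := congrArg₂ (· + ·) h0 h1
    rw [← integral_add (integrableOn_polarRect_mul hg2 (by fun_prop))
      (integrableOn_polarRect_mul hg2 (by fun_prop)), ← neg_add,
      ← integral_add (integrableOn_polarRect_mul iE₀ (by fun_prop))
        (integrableOn_polarRect_mul iE₁ (by fun_prop))] at s
    convert s using 1
    · refine integral_congr_ae (ae_of_all _ fun p => ?_)
      simp only
      rw [hψ.fderiv_mul_comp_snd (Real.hasDerivAt_cos p.2),
        hψ.fderiv_mul_comp_snd (Real.hasDerivAt_cos p.2),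
        hψ.fderiv_mul_comp_snd (Real.hasDerivAt_sin p.2),
        hψ.fderiv_mul_comp_snd (Real.hasDerivAt_sin p.2)]
      linear_combination -g p.2 * p.1 * (p.1 * fderiv ℝ ψ p (1, 0) + ψ p) *
        Real.sin_sq_add_cos_sq p.2
    · congr 1
      refine integral_congr_ae (ae_of_all _ fun p => ?_)
      simp only
      ring
  have hang : ∀ ψ, IsPolarTest ψ →
      ∫ p in polarRect, g p.2 * (p.1 * fderiv ℝ ψ p (0, 1)) =
      -∫ p in polarRect, (E₁ p * Real.cos p.2 - E₀ p * Real.sin p.2) * ψ p := fun ψ hψ => by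
    have h0 := hw0 _ (hψ.mul hsin)
    have h1 := hw1 _ (hψ.mul hcos)
    have c0 := (hψ.mul hcos).continuous_fderiv
    have c1 := (hψ.mul hsin).continuous_fderiv
    have c2 := hψ.contDiff.continuous
    have s := congrArg₂ (· - ·) h1 h0
    rw [← integral_sub (integrableOn_polarRect_mul hg2 (by fun_prop))
      (integrableOn_polarRect_mul hg2 (by fun_prop)), ← neg_sub',
      ← integral_sub (integrableOn_polarRect_mul iE₁ (by fun_prop))
        (integrableOn_polarRect_mul iE₀ (by fun_prop))] at s
    convert s using 1
    · refine integral_congr_ae (ae_of_all _ fun p => ?_)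
      simp only
      rw [hψ.fderiv_mul_comp_snd (Real.hasDerivAt_cos p.2),
        hψ.fderiv_mul_comp_snd (Real.hasDerivAt_cos p.2),
        hψ.fderiv_mul_comp_snd (Real.hasDerivAt_sin p.2),
        hψ.fderiv_mul_comp_snd (Real.hasDerivAt_sin p.2)]
      linear_combination -g p.2 * p.1 * fderiv ℝ ψ p (0, 1) * Real.sin_sq_add_cos_sq p.2
    · congr 1
      refine integral_congr_ae (ae_of_all _ fun p => ?_)
      simp only
      ring
  have iRad : IntegrableOn (fun p : ℝ × ℝ => E₀ p * Real.cos p.2 + E₁ p * Real.sin p.2)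
      polarRect :=
    (integrableOn_polarRect_mul iE₀ (by fun_prop)).add
      (integrableOn_polarRect_mul iE₁ (by fun_prop))
  have iT : IntegrableOn (fun p : ℝ × ℝ => E₁ p * Real.cos p.2 - E₀ p * Real.sin p.2)
      polarRect :=
    (integrableOn_polarRect_mul iE₁ (by fun_prop)).sub
      (integrableOn_polarRect_mul iE₀ (by fun_prop))
  set T : ℝ × ℝ → ℝ := fun p => E₁ p * Real.cos p.2 - E₀ p * Real.sin p.2 with hT
  have aeRad : ∀ᵐ p : ℝ × ℝ, p ∈ polarRect →
      E₀ p * Real.cos p.2 + E₁ p * Real.sin p.2 - g p.2 * p.1 = 0 := by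
    refine ae_eq_zero_of_integral_mul_polarTest
      (iRad.sub (integrableOn_polarRect_mul hg2 continuous_fst)) fun ψ hψ => ?_
    have h1 := hrad ψ hψ
    have h2 := setIntegral_polarRect_radial hgi hψ
    have c1 := hψ.continuous_fderiv (1, 0)
    have c2 := hψ.contDiff.continuous
    have e : ∀ p : ℝ × ℝ, (E₀ p * Real.cos p.2 + E₁ p * Real.sin p.2 - g p.2 * p.1) * ψ p =
        (E₀ p * Real.cos p.2 + E₁ p * Real.sin p.2) * ψ p -
        (g p.2 * (p.1 * (p.1 * fderiv ℝ ψ p (1, 0) + 2 * ψ p)) -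
          g p.2 * (p.1 * (p.1 * fderiv ℝ ψ p (1, 0) + ψ p))) := fun p => by ring
    simp_rw [e]
    have i1 : IntegrableOn (fun p : ℝ × ℝ =>
        g p.2 * (p.1 * (p.1 * fderiv ℝ ψ p (1, 0) + 2 * ψ p))) polarRect :=
      integrableOn_polarRect_mul hg2 (by fun_prop)
    have i2 : IntegrableOn (fun p : ℝ × ℝ =>
        g p.2 * (p.1 * (p.1 * fderiv ℝ ψ p (1, 0) + ψ p))) polarRect :=
      integrableOn_polarRect_mul hg2 (by fun_prop)
    have i3 : IntegrableOn (fun p : ℝ × ℝ =>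
        g p.2 * (p.1 * (p.1 * fderiv ℝ ψ p (1, 0) + 2 * ψ p)) -
          g p.2 * (p.1 * (p.1 * fderiv ℝ ψ p (1, 0) + ψ p))) polarRect := i1.sub i2
    rw [integral_sub (integrableOn_polarRect_mul iRad c2) i3, integral_sub i1 i2, h1, h2]
    ring
  -- averaging the angular component in the radius
  obtain ⟨β, hβ, hβc, hβs, hβ0, hβ1⟩ := exists_bump_integral_eq_one (zero_lt_one (α := ℝ))
  set κ := ∫ R in Ioo (0 : ℝ) 1, R * β R with hκ
  have hκ0 : κ ≠ 0 := (integral_mul_bump_pos hβ.continuous hβs hβ0 hβ1).ne'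
  set ξ : ℝ → ℝ := fun θ => κ⁻¹ * ∫ R in Ioo (0 : ℝ) 1, T (R, θ) * β R with hξ
  have iTβ : IntegrableOn (fun p : ℝ × ℝ => T p * β p.1) polarRect :=
    integrableOn_polarRect_mul iT (hβ.continuous.comp continuous_fst)
  have iξ : IntegrableOn ξ (Ioo (-Real.pi) Real.pi) := by
    have h := iTβ
    rw [IntegrableOn, volume_restrict_polarRect] at h
    exact h.integral_prod_right.const_mul _
  have hpi := Real.pi_pos
  obtain ⟨k, hk⟩ := ae_eq_primitive_of_integral_mul_deriv (K := g) (H := ξ) (c := 0)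
    (by linarith) (by constructor <;> linarith) hgi iξ (fun η hη hηc hηs => by
      have ht := IsPolarTest.prod hβ hβc hβs hη hηc hηs
      have h1 := hang _ ht
      have hf : ∀ p : ℝ × ℝ, fderiv ℝ (fun p : ℝ × ℝ => β p.1 * η p.2) p (0, 1) =
          β p.1 * deriv η p.2 := fun p =>
        (ht.hasDerivAt_snd p.1 p.2).unique
          (((hη.differentiable (by simp) p.2).hasDerivAt).const_mul (β p.1))
      simp_rw [hf] at h1
      have cd : Continuous (deriv η) := hη.continuous_deriv (by simp)
      have cη := hη.continuous
      have cβ := hβ.continuous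
      rw [setIntegral_polarRect_symm (integrableOn_polarRect_mul hg2 (by fun_prop)),
        setIntegral_polarRect_symm (integrableOn_polarRect_mul iT (by fun_prop))] at h1
      have e1 : ∀ θ, ∫ R in Ioo (0 : ℝ) 1, g θ * (R * (β R * deriv η θ)) =
          κ * (g θ * deriv η θ) := fun θ => by
        rw [hκ, ← integral_mul_const]
        exact integral_congr_ae (ae_of_all _ fun R => by simp only; ring)
      have e2 : ∀ θ, ∫ R in Ioo (0 : ℝ) 1, T (R, θ) * (β R * η θ) = κ * (ξ θ * η θ) := fun θ => by
        simp only [hξ]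
        rw [← mul_assoc, ← mul_assoc, mul_inv_cancel₀ hκ0, one_mul, ← integral_mul_const]
        exact integral_congr_ae (ae_of_all _ fun R => by simp only; ring)
      simp only [e1, e2] at h1
      rw [integral_const_mul, integral_const_mul, ← mul_neg] at h1
      exact mul_left_cancel₀ hκ0 h1)
  refine ⟨k, ξ, iξ, hk, ?_⟩
  have hk2 : ∀ᵐ p : ℝ × ℝ, p ∈ polarRect → g p.2 = k + ∫ s in (0 : ℝ)..p.2, ξ s := by
    filter_upwards [Measure.quasiMeasurePreserving_snd.ae hk] with p hp hpQ using hp hpQ.2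
  have aeT : ∀ᵐ p : ℝ × ℝ, p ∈ polarRect → T p - ξ p.2 * p.1 = 0 := by
    have iξ2 := integrableOn_polarRect_comp_snd iξ
    refine ae_eq_zero_of_integral_mul_polarTest
      (iT.sub (integrableOn_polarRect_mul iξ2 continuous_fst)) fun ψ hψ => ?_
    have h1 := hang ψ hψ
    have h2 := setIntegral_polarRect_angular iξ k hψ
    have h3 : ∫ p in polarRect, g p.2 * (p.1 * fderiv ℝ ψ p (0, 1)) =
        ∫ p in polarRect, (k + ∫ s in (0 : ℝ)..p.2, ξ s) * (p.1 * fderiv ℝ ψ p (0, 1)) := by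
      refine integral_congr_ae ((ae_restrict_iff' measurableSet_polarRect).2 ?_)
      filter_upwards [hk2] with p hp hpQ
      rw [hp hpQ]
    have c2 := hψ.contDiff.continuous
    have e : ∀ p : ℝ × ℝ, (T p - ξ p.2 * p.1) * ψ p = T p * ψ p - ξ p.2 * (p.1 * ψ p) :=
      fun p => by ring
    simp_rw [e]
    rw [integral_sub (integrableOn_polarRect_mul iT c2)
      (integrableOn_polarRect_mul iξ2 (by fun_prop))]
    linarith
  filter_upwards [aeRad, aeT] with p h1 h2 hp
  have h1 := h1 hp
  have h2 := h2 hp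
  simp only [hT, hE₀, hE₁] at h1 h2
  have hcs := Real.sin_sq_add_cos_sq p.2
  have hp0 : p.1 ≠ 0 := hp.1.1.ne'
  constructor
  · apply mul_left_cancel₀ hp0
    linear_combination Real.cos p.2 * h1 - Real.sin p.2 * h2 -
      p.1 * D 0 (polarPoint p.1 p.2) * hcs
  · apply mul_left_cancel₀ hp0
    linear_combination Real.sin p.2 * h1 + Real.cos p.2 * h2 -
      p.1 * D 1 (polarPoint p.1 p.2) * hcs

/-! ### Joint differentiability of the coefficients -/

/-- First order expansion in one real variable, uniform in a parameter. -/
theorem isLittleO_sub_sub_of_hasDerivAt {α E : Type*} [NormedAddCommGroup E] [NormedSpace ℝ E]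
    {l : Filter α} {v : α → ℝ} {s₀ : ℝ} (hv : Tendsto v l (𝓝 s₀)) {f f' : α → ℝ → E} {φ : E}
    (df : ∀ᶠ p in l ×ˢ 𝓝 s₀, HasDerivAt (f p.1) (f' p.1 p.2) p.2)
    (cf : Tendsto (fun p : α × ℝ => f' p.1 p.2) (l ×ˢ 𝓝 s₀) (𝓝 φ)) :
    (fun χ => f χ (v χ) - f χ s₀ - (v χ - s₀) • φ) =o[l] fun χ => v χ - s₀ := by
  refine Asymptotics.isLittleO_iff.2 fun ε hε => ?_
  have h1 : ∀ᶠ p in l ×ˢ 𝓝 s₀, ‖f' p.1 p.2 - φ‖ ≤ ε := by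
    filter_upwards [cf.eventually (Metric.closedBall_mem_nhds φ hε)] with p hp
    rwa [← dist_eq_norm]
  obtain ⟨pa, hpa, pb, hpb, hab⟩ := eventually_prod_iff.1 (df.and h1)
  obtain ⟨δ, hδ, hball⟩ := Metric.eventually_nhds_iff_ball.1 hpb
  filter_upwards [hpa, hv.eventually (Metric.ball_mem_nhds s₀ hδ)] with χ h2 h3
  have key := Convex.norm_image_sub_le_of_norm_hasDerivWithin_le
    (f := fun s => f χ s - s • φ) (f' := fun s => f' χ s - φ) (C := ε) (s := Metric.ball s₀ δ)
    (fun s hs => by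
      have h4 := (hab h2 (hball s hs)).1
      have h5 := h4.sub ((hasDerivAt_id s).smul_const φ)
      rw [one_smul] at h5
      exact h5.hasDerivWithinAt)
    (fun s hs => (hab h2 (hball s hs)).2) (convex_ball _ _) (Metric.mem_ball_self hδ) h3
  convert key using 2
  module

section Coefficients

variable {m : ℕ} {A : Plane → Mat m → Mat m}

theorem isOpen_puncturedDisc : IsOpen (unitDisc \ {0}) :=
  Metric.isOpen_ball.sdiff isClosed_singleton

theorem continuousAt_partialX (hx : HasContinuousSpatialDerivatives A) (i : Fin 2) {x₀ : Plane}
    (h : x₀ ∈ unitDisc \ {0}) (F₀ : Mat m) :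
    ContinuousAt (fun z : Plane × Mat m => partialX A i z.1 z.2) (x₀, F₀) := by
  have hopen : IsOpen ((unitDisc \ {0}) ×ˢ (univ : Set (Mat m))) :=
    isOpen_puncturedDisc.prod isOpen_univ
  have hmem : (unitDisc \ {0}) ×ˢ (univ : Set (Mat m)) ∈ 𝓝 (x₀, F₀) :=
    hopen.mem_nhds ⟨h, mem_univ _⟩
  have h1 := (hx i).2.continuousAt hmem
  have h0 : ‖x₀‖ ≠ 0 := norm_ne_zero_iff.2 h.2
  have h2 : ContinuousAt (fun z : Plane × Mat m => ‖z.1‖⁻¹ • (‖z.1‖ • partialX A i z.1 z.2))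
      (x₀, F₀) := (continuous_fst.norm.continuousAt.inv₀ h0).smul h1
  refine h2.congr ?_
  filter_upwards [hmem] with z hz
  rw [inv_smul_smul₀ (norm_ne_zero_iff.2 hz.1.2)]

theorem hasDerivAt_coeff_fst (hx : HasContinuousSpatialDerivatives A) {p : ℝ × ℝ}
    (h : planeEquiv p ∈ unitDisc \ {0}) (F : Mat m) :
    HasDerivAt (fun s => A (planeEquiv (s, p.2)) F) (partialX A 0 (planeEquiv p) F) p.1 := by
  have h1 : HasDerivAt (fun t : ℝ => A (planeEquiv p + t • coordVec 0) F)
      (partialX A 0 (planeEquiv p) F) (p.1 - p.1) := by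
    rw [sub_self]; exact ((hx 0).1 _ h F).hasLineDerivAt
  have h2 := HasDerivAt.scomp (h := fun s => s - p.1) p.1 h1 ((hasDerivAt_id p.1).sub_const p.1)
  rw [one_smul] at h2
  refine h2.congr_of_eventuallyEq (Eventually.of_forall fun s => ?_)
  simp only [Function.comp]
  congr 1
  simp only [planeEquiv_apply, vec_eq_smul_coordVec]
  module

theorem hasDerivAt_coeff_snd (hx : HasContinuousSpatialDerivatives A) {p : ℝ × ℝ}
    (h : planeEquiv p ∈ unitDisc \ {0}) (F : Mat m) :
    HasDerivAt (fun s => A (planeEquiv (p.1, s)) F) (partialX A 1 (planeEquiv p) F) p.2 := by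
  have h1 : HasDerivAt (fun t : ℝ => A (planeEquiv p + t • coordVec 1) F)
      (partialX A 1 (planeEquiv p) F) (p.2 - p.2) := by
    rw [sub_self]; exact ((hx 1).1 _ h F).hasLineDerivAt
  have h2 := HasDerivAt.scomp (h := fun s => s - p.2) p.2 h1 ((hasDerivAt_id p.2).sub_const p.2)
  rw [one_smul] at h2
  refine h2.congr_of_eventuallyEq (Eventually.of_forall fun s => ?_)
  simp only [Function.comp]
  congr 1
  simp only [planeEquiv_apply, vec_eq_smul_coordVec]
  module

/-- The total derivative of `(x, F) ↦ A(x, F)`. The derivatives in `x` are jointly continuous, the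
derivative in `F` need only exist at the point in question. -/
noncomputable def coeffDeriv (A : Plane → Mat m → Mat m) (z : (ℝ × ℝ) × Mat m) :
    (ℝ × ℝ) × Mat m →L[ℝ] Mat m :=
  ((ContinuousLinearMap.fst ℝ ℝ ℝ).comp (ContinuousLinearMap.fst ℝ (ℝ × ℝ) (Mat m))).smulRight
      (partialX A 0 (planeEquiv z.1) z.2) +
    ((ContinuousLinearMap.snd ℝ ℝ ℝ).comp (ContinuousLinearMap.fst ℝ (ℝ × ℝ) (Mat m))).smulRight
      (partialX A 1 (planeEquiv z.1) z.2) +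
    (fderiv ℝ (A (planeEquiv z.1)) z.2).comp (ContinuousLinearMap.snd ℝ (ℝ × ℝ) (Mat m))

theorem coeffDeriv_apply (A : Plane → Mat m → Mat m) (z w : (ℝ × ℝ) × Mat m) :
    coeffDeriv A z w = w.1.1 • partialX A 0 (planeEquiv z.1) z.2 +
      w.1.2 • partialX A 1 (planeEquiv z.1) z.2 + fderiv ℝ (A (planeEquiv z.1)) z.2 w.2 := rfl

/-- Joint differentiability of `A`. The increment in `x` is taken first, at the moving `F`, where the
joint continuity of `∂A/∂x` applies; the increment in `F` is then taken at the fixed point. -/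
theorem hasFDerivAt_coeff (hC1 : IsC1InGradient A) (hx : HasContinuousSpatialDerivatives A)
    {p₀ : ℝ × ℝ} (h : planeEquiv p₀ ∈ unitDisc \ {0}) (F₀ : Mat m) :
    HasFDerivAt (fun z : (ℝ × ℝ) × Mat m => A (planeEquiv z.1) z.2)
      (coeffDeriv A (p₀, F₀)) (p₀, F₀) := by
  set l : Filter ((ℝ × ℝ) × Mat m) := 𝓝 (p₀, F₀) with hl
  have hpre : IsOpen (planeEquiv ⁻¹' (unitDisc \ {0})) :=
    isOpen_puncturedDisc.preimage planeEquiv.continuous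
  have hpre₀ : ∀ᶠ p in 𝓝 p₀, planeEquiv p ∈ unitDisc \ {0} := hpre.mem_nhds h
  have t1 : Tendsto (fun χ : (ℝ × ℝ) × Mat m => χ.1.1) l (𝓝 p₀.1) :=
    (continuous_fst.comp continuous_fst).tendsto _
  have t2 : Tendsto (fun χ : (ℝ × ℝ) × Mat m => χ.1.2) l (𝓝 p₀.2) :=
    (continuous_snd.comp continuous_fst).tendsto _
  have t3 : Tendsto (fun χ : (ℝ × ℝ) × Mat m => χ.2) l (𝓝 F₀) := continuous_snd.tendsto _
  have hc : ∀ i, Tendsto (fun z : Plane × Mat m => partialX A i z.1 z.2) (𝓝 (planeEquiv p₀, F₀))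
      (𝓝 (partialX A i (planeEquiv p₀) F₀)) := fun i => continuousAt_partialX hx i h F₀
  -- increments in the first coordinate, the second one and `F` being parameters
  have o1 : (fun χ : (ℝ × ℝ) × Mat m => A (planeEquiv (χ.1.1, χ.1.2)) χ.2 -
      A (planeEquiv (p₀.1, χ.1.2)) χ.2 - (χ.1.1 - p₀.1) • partialX A 0 (planeEquiv p₀) F₀)
      =o[l] fun χ => χ.1.1 - p₀.1 := by
    have ht : Tendsto (fun q : ((ℝ × ℝ) × Mat m) × ℝ => (q.2, q.1.1.2)) (l ×ˢ 𝓝 p₀.1)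
        (𝓝 p₀) := (tendsto_snd.prodMk_nhds (t2.comp tendsto_fst))
    have ht' : Tendsto (fun q : ((ℝ × ℝ) × Mat m) × ℝ => (planeEquiv (q.2, q.1.1.2), q.1.2))
        (l ×ˢ 𝓝 p₀.1) (𝓝 (planeEquiv p₀, F₀)) :=
      ((planeEquiv.continuous.tendsto p₀).comp ht).prodMk_nhds (t3.comp tendsto_fst)
    have df : ∀ᶠ q : ((ℝ × ℝ) × Mat m) × ℝ in l ×ˢ 𝓝 p₀.1,
        HasDerivAt (fun s => A (planeEquiv (s, q.1.1.2)) q.1.2)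
          (partialX A 0 (planeEquiv (q.2, q.1.1.2)) q.1.2) q.2 := by
      filter_upwards [ht.eventually hpre₀] with q hq
      exact hasDerivAt_coeff_fst (p := (q.2, q.1.1.2)) hx hq q.1.2
    have cf : Tendsto (fun q : ((ℝ × ℝ) × Mat m) × ℝ =>
        partialX A 0 (planeEquiv (q.2, q.1.1.2)) q.1.2) (l ×ˢ 𝓝 p₀.1)
        (𝓝 (partialX A 0 (planeEquiv p₀) F₀)) :=
      ((hc 0).comp ht').congr fun q => by rw [Function.comp_apply]
    exact isLittleO_sub_sub_of_hasDerivAt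
      (f := fun (χ : (ℝ × ℝ) × Mat m) s => A (planeEquiv (s, χ.1.2)) χ.2)
      (f' := fun (χ : (ℝ × ℝ) × Mat m) s => partialX A 0 (planeEquiv (s, χ.1.2)) χ.2) t1 df cf
  -- increments in the second coordinate
  have o2 : (fun χ : (ℝ × ℝ) × Mat m => A (planeEquiv (p₀.1, χ.1.2)) χ.2 -
      A (planeEquiv (p₀.1, p₀.2)) χ.2 - (χ.1.2 - p₀.2) • partialX A 1 (planeEquiv p₀) F₀)
      =o[l] fun χ => χ.1.2 - p₀.2 := by
    have ht : Tendsto (fun q : ((ℝ × ℝ) × Mat m) × ℝ => (p₀.1, q.2)) (l ×ˢ 𝓝 p₀.2)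
        (𝓝 p₀) := tendsto_const_nhds.prodMk_nhds tendsto_snd
    have ht' : Tendsto (fun q : ((ℝ × ℝ) × Mat m) × ℝ => (planeEquiv (p₀.1, q.2), q.1.2))
        (l ×ˢ 𝓝 p₀.2) (𝓝 (planeEquiv p₀, F₀)) :=
      ((planeEquiv.continuous.tendsto p₀).comp ht).prodMk_nhds (t3.comp tendsto_fst)
    have df : ∀ᶠ q : ((ℝ × ℝ) × Mat m) × ℝ in l ×ˢ 𝓝 p₀.2,
        HasDerivAt (fun s => A (planeEquiv (p₀.1, s)) q.1.2)
          (partialX A 1 (planeEquiv (p₀.1, q.2)) q.1.2) q.2 := by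
      filter_upwards [ht.eventually hpre₀] with q hq
      exact hasDerivAt_coeff_snd (p := (p₀.1, q.2)) hx hq q.1.2
    have cf : Tendsto (fun q : ((ℝ × ℝ) × Mat m) × ℝ =>
        partialX A 1 (planeEquiv (p₀.1, q.2)) q.1.2) (l ×ˢ 𝓝 p₀.2)
        (𝓝 (partialX A 1 (planeEquiv p₀) F₀)) :=
      ((hc 1).comp ht').congr fun q => by rw [Function.comp_apply]
    exact isLittleO_sub_sub_of_hasDerivAt
      (f := fun (χ : (ℝ × ℝ) × Mat m) s => A (planeEquiv (p₀.1, s)) χ.2)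
      (f' := fun (χ : (ℝ × ℝ) × Mat m) s => partialX A 1 (planeEquiv (p₀.1, s)) χ.2) t2 df cf
  have o3 : (fun χ : (ℝ × ℝ) × Mat m => A (planeEquiv p₀) χ.2 - A (planeEquiv p₀) F₀ -
      fderiv ℝ (A (planeEquiv p₀)) F₀ (χ.2 - F₀)) =o[l] fun χ => χ.2 - F₀ :=
    (((hC1 _ h.1).differentiable (by simp) F₀).hasFDerivAt.isLittleO).comp_tendsto t3
  have b1 : (fun χ : (ℝ × ℝ) × Mat m => χ.1.1 - p₀.1) =O[l] fun χ => χ - (p₀, F₀) :=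
    Asymptotics.IsBigO.of_bound 1 (Eventually.of_forall fun χ => by
      rw [one_mul]
      exact (norm_fst_le (χ.1 - p₀)).trans (norm_fst_le (χ - (p₀, F₀))))
  have b2 : (fun χ : (ℝ × ℝ) × Mat m => χ.1.2 - p₀.2) =O[l] fun χ => χ - (p₀, F₀) :=
    Asymptotics.IsBigO.of_bound 1 (Eventually.of_forall fun χ => by
      rw [one_mul]
      exact (norm_snd_le (χ.1 - p₀)).trans (norm_fst_le (χ - (p₀, F₀))))
  have b3 : (fun χ : (ℝ × ℝ) × Mat m => χ.2 - F₀) =O[l] fun χ => χ - (p₀, F₀) :=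
    Asymptotics.IsBigO.of_bound 1 (Eventually.of_forall fun χ => by
      rw [one_mul]
      exact norm_snd_le (χ - (p₀, F₀)))
  refine HasFDerivAt.of_isLittleO ?_
  have o4 := ((o1.trans_isBigO b1).add (o2.trans_isBigO b2)).add (o3.trans_isBigO b3)
  refine o4.congr_left fun χ => ?_
  rw [coeffDeriv_apply, Prod.mk.eta]
  simp only [Prod.fst_sub, Prod.snd_sub, Prod.mk.eta]
  abel

theorem continuousAt_coeff (hC1 : IsC1InGradient A) (hx : HasContinuousSpatialDerivatives A)
    {x₀ : Plane} (h : x₀ ∈ unitDisc \ {0}) (F₀ : Mat m) :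
    ContinuousAt (fun z : Plane × Mat m => A z.1 z.2) (x₀, F₀) := by
  have h1 : planeEquiv (planeEquiv.symm x₀) ∈ unitDisc \ {0} := by simpa using! h
  have h2 := (hasFDerivAt_coeff hC1 hx h1 F₀).continuousAt
  have h3 : ContinuousAt (fun z : Plane × Mat m => (planeEquiv.symm z.1, z.2)) (x₀, F₀) := by
    fun_prop
  have h4 := ContinuousAt.comp (x := (x₀, F₀)) h2 h3
  simpa [Function.comp_def] using! h4

/-- The chain rule along a curve. -/
theorem hasDerivAt_coeff_curve (hC1 : IsC1InGradient A)
    (hx : HasContinuousSpatialDerivatives A) {a b : ℝ → ℝ} {a' b' : ℝ} {F : ℝ → Mat m} {F' : Mat m} {t : ℝ} (ha : HasDerivAt a a' t)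
    (hb : HasDerivAt b b' t) (hF : HasDerivAt F F' t)
    (h : planeEquiv (a t, b t) ∈ unitDisc \ {0}) :
    HasDerivAt (fun s => A (planeEquiv (a s, b s)) (F s))
      (a' • partialX A 0 (planeEquiv (a t, b t)) (F t) +
        b' • partialX A 1 (planeEquiv (a t, b t)) (F t) +
        fderiv ℝ (A (planeEquiv (a t, b t))) (F t) F') t :=
  HasFDerivAt.comp_hasDerivAt (f := fun s => ((a s, b s), F s)) t
    (hasFDerivAt_coeff hC1 hx h (F t)) ((ha.prodMk hb).prodMk hF)

end Coefficients

/-! ### The moving frame and strong monotonicity -/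

section Frame

variable {m : ℕ}

/-- The matrix with radial component `g` and angular component `ξ`, that is `g ⊗ e_R + ξ ⊗ e_θ`. -/
noncomputable def polarGrad (θ : ℝ) (g ξ : EuclideanSpace ℝ (Fin m)) : Mat m := fun p =>
  ![g p * Real.cos θ - ξ p * Real.sin θ, g p * Real.sin θ + ξ p * Real.cos θ]

/-- The radial component `a e_R` of a matrix. -/
noncomputable def radialPart (θ : ℝ) (a : Mat m) : EuclideanSpace ℝ (Fin m) :=
  WithLp.toLp 2 fun p => a p 0 * Real.cos θ + a p 1 * Real.sin θ

/-- The angular component `a e_θ` of a matrix. -/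
noncomputable def angularPart (θ : ℝ) (a : Mat m) : EuclideanSpace ℝ (Fin m) :=
  WithLp.toLp 2 fun p => a p 1 * Real.cos θ - a p 0 * Real.sin θ

theorem radialPart_apply (θ : ℝ) (a : Mat m) (p : Fin m) :
    radialPart θ a p = a p 0 * Real.cos θ + a p 1 * Real.sin θ := rfl

theorem angularPart_apply (θ : ℝ) (a : Mat m) (p : Fin m) :
    angularPart θ a p = a p 1 * Real.cos θ - a p 0 * Real.sin θ := rfl

theorem continuous_polarGrad :
    Continuous fun z : ℝ × EuclideanSpace ℝ (Fin m) × EuclideanSpace ℝ (Fin m) =>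
      polarGrad z.1 z.2.1 z.2.2 := by
  refine continuous_pi fun p => continuous_pi fun q => ?_
  fin_cases q <;> simp [polarGrad] <;> fun_prop

theorem continuous_radialPart : Continuous fun z : ℝ × Mat m => radialPart z.1 z.2 :=
  (PiLp.continuous_toLp 2 _).comp (continuous_pi fun p => by fun_prop)

theorem continuous_angularPart : Continuous fun z : ℝ × Mat m => angularPart z.1 z.2 :=
  (PiLp.continuous_toLp 2 _).comp (continuous_pi fun p => by fun_prop)

theorem angularPart_add (θ : ℝ) (a b : Mat m) :
    angularPart θ (a + b) = angularPart θ a + angularPart θ b := by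
  ext p; simp [angularPart_apply]; ring

theorem angularPart_smul (θ c : ℝ) (a : Mat m) :
    angularPart θ (c • a) = c • angularPart θ a := by
  ext p; simp [angularPart_apply]; ring

theorem polarGrad_add (θ : ℝ) (g ξ g' ξ' : EuclideanSpace ℝ (Fin m)) :
    polarGrad θ (g + g') (ξ + ξ') = polarGrad θ g ξ + polarGrad θ g' ξ' := by
  ext p q; fin_cases q <;> simp [polarGrad] <;> ring

theorem polarGrad_smul (θ c : ℝ) (g ξ : EuclideanSpace ℝ (Fin m)) :
    polarGrad θ (c • g) (c • ξ) = c • polarGrad θ g ξ := by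
  ext p q; fin_cases q <;> simp [polarGrad] <;> ring

theorem hasDerivAt_angularPart {a : ℝ → Mat m} {a' : Mat m} {θ : ℝ} (ha : HasDerivAt a a' θ) :
    HasDerivAt (fun t => angularPart t (a t)) (angularPart θ a' - radialPart θ (a θ)) θ := by
  have h : HasDerivAt (fun t p => a t p 1 * Real.cos t - a t p 0 * Real.sin t)
      (fun p => (a' p 1 * Real.cos θ - a' p 0 * Real.sin θ) -
        (a θ p 0 * Real.cos θ + a θ p 1 * Real.sin θ)) θ := by
    refine hasDerivAt_pi.2 fun p => ?_
    have h0 := hasDerivAt_pi.1 (hasDerivAt_pi.1 ha p) 0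
    have h1 := hasDerivAt_pi.1 (hasDerivAt_pi.1 ha p) 1
    refine ((h1.mul (Real.hasDerivAt_cos θ)).sub (h0.mul (Real.hasDerivAt_sin θ))).congr_deriv ?_
    ring
  exact (PiLp.continuousLinearEquiv 2 ℝ (fun _ : Fin m => ℝ)).symm.hasFDerivAt.comp_hasDerivAt θ h

theorem hasDerivAt_polarGrad {g ξ : ℝ → EuclideanSpace ℝ (Fin m)}
    {g' ξ' : EuclideanSpace ℝ (Fin m)} {θ : ℝ} (hg : HasDerivAt g g' θ) (hξ : HasDerivAt ξ ξ' θ) :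
    HasDerivAt (fun t => polarGrad t (g t) (ξ t)) (polarGrad θ (g' - ξ θ) (g θ + ξ')) θ := by
  refine hasDerivAt_pi.2 fun p => hasDerivAt_pi.2 fun q => ?_
  have h0 : HasDerivAt (fun t => g t p) (g' p) θ :=
    (PiLp.proj 2 (𝕜 := ℝ) (fun _ : Fin m => ℝ) p).hasFDerivAt.comp_hasDerivAt θ hg
  have h1 : HasDerivAt (fun t => ξ t p) (ξ' p) θ :=
    (PiLp.proj 2 (𝕜 := ℝ) (fun _ : Fin m => ℝ) p).hasFDerivAt.comp_hasDerivAt θ hξ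
  fin_cases q
  · refine ((h0.mul (Real.hasDerivAt_cos θ)).sub (h1.mul (Real.hasDerivAt_sin θ))).congr_deriv ?_
    simp [polarGrad]; ring
  · refine ((h0.mul (Real.hasDerivAt_sin θ)).add (h1.mul (Real.hasDerivAt_cos θ))).congr_deriv ?_
    simp [polarGrad]; ring

variable {A : Plane → Mat m → Mat m} {ν : ℝ}

/-- The Legendre–Hadamard condition with the constant `ν`. -/
def IsEllipticWith (A : Plane → Mat m → Mat m) (ν : ℝ) : Prop :=
  ∀ x ∈ unitDisc, ∀ F : Mat m, ∀ (a : EuclideanSpace ℝ (Fin m)) (b : Plane),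
    ν * ‖a‖ ^ 2 * ‖b‖ ^ 2 ≤
      ∑ p : Fin m, ∑ q : Fin 2, ∑ r : Fin m, ∑ s : Fin 2,
        partialF A x F p q r s * a p * b q * a r * b s

/-- Ellipticity in the direction `w ⊗ e_θ`. -/
theorem IsEllipticWith.le_inner_fderiv (h : IsEllipticWith A ν) {x : Plane} (hx : x ∈ unitDisc)
    (F : Mat m) (θ : ℝ) (w : EuclideanSpace ℝ (Fin m)) :
    ν * ‖w‖ ^ 2 ≤ inner ℝ (angularPart θ (fderiv ℝ (A x) F (polarGrad θ 0 w))) w := by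
  set b : Plane := !₂[-Real.sin θ, Real.cos θ] with hb
  have hb1 : ‖b‖ ^ 2 = 1 := by
    rw [EuclideanSpace.norm_sq_eq, Fin.sum_univ_two]
    simp [hb]
  have key := h x hx F w b
  rw [hb1, mul_one] at key
  refine key.trans_eq ?_
  have hM : polarGrad θ 0 w = ∑ r : Fin m, ∑ s : Fin 2,
      (w r * b s) • (Pi.single r (Pi.single s (1 : ℝ)) : Mat m) := by
    ext p q
    simp only [Finset.sum_apply, Fin.sum_univ_two]
    rw [Finset.sum_eq_single p]
    · fin_cases q <;> simp [polarGrad, hb]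
    · intro r _ hr
      simp [Pi.single_eq_of_ne hr.symm]
    · simp
  have hL : ∀ p q, fderiv ℝ (A x) F (polarGrad θ 0 w) p q =
      ∑ r : Fin m, ∑ s : Fin 2, partialF A x F p q r s * (w r * b s) := fun p q => by
    rw [hM, map_sum, Finset.sum_apply, Finset.sum_apply]
    refine Finset.sum_congr rfl fun r _ => ?_
    rw [map_sum, Finset.sum_apply, Finset.sum_apply]
    refine Finset.sum_congr rfl fun s _ => ?_
    rw [map_smul, partialF, Pi.smul_apply, Pi.smul_apply, smul_eq_mul, mul_comm]
  rw [PiLp.inner_apply]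
  refine Finset.sum_congr rfl fun p _ => ?_
  have e : ∀ q : Fin 2, (∑ r : Fin m, ∑ s : Fin 2,
      partialF A x F p q r s * w p * b q * w r * b s) =
      w p * b q * fderiv ℝ (A x) F (polarGrad θ 0 w) p q := fun q => by
    rw [hL, Finset.mul_sum]
    refine Finset.sum_congr rfl fun r _ => ?_
    rw [Finset.mul_sum]
    exact Finset.sum_congr rfl fun s _ => by ring
  simp_rw [e, Fin.sum_univ_two, angularPart_apply]
  simp [hb]
  ring

/-- The angular flux is strongly monotone in the angular component of the gradient. -/
theorem IsEllipticWith.le_inner_sub (h : IsEllipticWith A ν) (hC1 : IsC1InGradient A) {x : Plane}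
    (hx : x ∈ unitDisc) (θ : ℝ) (g ξ ζ : EuclideanSpace ℝ (Fin m)) :
    ν * ‖ξ - ζ‖ ^ 2 ≤ inner ℝ (angularPart θ (A x (polarGrad θ g ξ)) -
      angularPart θ (A x (polarGrad θ g ζ))) (ξ - ζ) := by
  set w := ξ - ζ with hw
  set F : ℝ → Mat m := fun t => polarGrad θ g ζ + t • polarGrad θ 0 w with hF
  have hFd : ∀ t, HasDerivAt F (polarGrad θ 0 w) t := fun t => by
    have := ((hasDerivAt_id t).smul_const (polarGrad θ 0 w)).const_add (polarGrad θ g ζ)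
    rw [one_smul] at this
    exact this
  have hAd : ∀ t, HasDerivAt (fun t => A x (F t)) (fderiv ℝ (A x) (F t) (polarGrad θ 0 w)) t :=
    fun t => (((hC1 x hx).differentiable (by simp) (F t)).hasFDerivAt).comp_hasDerivAt t (hFd t)
  have hf : ∀ t, HasDerivAt (fun t => inner ℝ (angularPart θ (A x (F t))) w)
      (inner ℝ (angularPart θ (fderiv ℝ (A x) (F t) (polarGrad θ 0 w))) w) t := fun t => by
    simp only [PiLp.inner_apply, angularPart_apply]
    refine HasDerivAt.fun_sum fun p _ => ?_
    have h0 := hasDerivAt_pi.1 (hasDerivAt_pi.1 (hAd t) p) 0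
    have h1 := hasDerivAt_pi.1 (hasDerivAt_pi.1 (hAd t) p) 1
    exact ((h1.mul_const (Real.cos θ)).sub (h0.mul_const (Real.sin θ))).const_mul (w p)
  obtain ⟨c, -, hc⟩ := exists_hasDerivAt_eq_slope
    (fun t => inner ℝ (angularPart θ (A x (F t))) w) _ zero_lt_one
    (fun t _ => (hf t).continuousAt.continuousWithinAt) (fun t _ => hf t)
  have h1 := h.le_inner_fderiv hx (F c) θ w
  have e0 : F 0 = polarGrad θ g ζ := by simp [hF]
  have e1 : F 1 = polarGrad θ g ξ := by
    rw [hF]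
    simp only [one_smul]
    rw [← polarGrad_add, add_zero, hw, add_sub_cancel]
  rw [hc, e0, e1, sub_zero, div_one, ← inner_sub_left] at h1
  exact h1

/-- The quantitative injectivity which follows from strong monotonicity. -/
theorem norm_mul_le_of_le_inner {E : Type*} [NormedAddCommGroup E] [InnerProductSpace ℝ E]
    {ν : ℝ} {v w : E} (h : ν * ‖w‖ ^ 2 ≤ inner ℝ v w) : ν * ‖w‖ ≤ ‖v‖ := by
  rcases (norm_nonneg w).eq_or_lt with h0 | h0
  · rw [← h0, mul_zero]; exact norm_nonneg _
  · have h1 := h.trans (real_inner_le_norm v w)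
    nlinarith

end Frame

/-! ### Regularity from strong monotonicity -/

/-- If `Φ` is continuous and strongly monotone in its last argument, a solution `ξ` of
`Φ(θ, g(θ), ξ(θ)) = K(θ)` for almost every `θ`, with `g` and `K` continuous, agrees almost everywhere
with a continuous function. -/
theorem exists_continuousOn_ae_eq_of_monotone {E : Type*} [NormedAddCommGroup E]
    [InnerProductSpace ℝ E] [FiniteDimensional ℝ E] {Φ : ℝ × E × E → E} (hΦ : Continuous Φ) {c : ℝ}
    (hc : 0 < c) {I : Set ℝ} (hI : IsOpen I)
    (hmono : ∀ θ g ξ ζ, c * ‖ξ - ζ‖ ^ 2 ≤ inner ℝ (Φ (θ, g, ξ) - Φ (θ, g, ζ)) (ξ - ζ))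
    {g K ξ : ℝ → E} (hg : ContinuousOn g I) (hK : ContinuousOn K I)
    (heq : ∀ᵐ θ, θ ∈ I → K θ = Φ (θ, g θ, ξ θ)) :
    ∃ ξ' : ℝ → E, ContinuousOn ξ' I ∧ ∀ᵐ θ, θ ∈ I → ξ θ = ξ' θ := by
  set G : Set ℝ := {θ | θ ∈ I ∧ K θ = Φ (θ, g θ, ξ θ)} with hG
  have hdense : I ⊆ closure G := by
    have h1 : Dense {θ | θ ∈ I → K θ = Φ (θ, g θ, ξ θ)} := Measure.dense_of_ae heq
    have h2 := h1.open_subset_closure_inter hI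
    exact h2.trans (closure_mono fun θ hθ => ⟨hθ.1, hθ.2 hθ.1⟩)
  have hlim : ∀ θ₀ ∈ I, ∃ y, Tendsto ξ (𝓝[G] θ₀) (𝓝 y) := by
    intro θ₀ hθ₀
    have hne : (𝓝[G] θ₀).NeBot := mem_closure_iff_nhdsWithin_neBot.1 (hdense hθ₀)
    have hid : Tendsto (fun θ : ℝ => θ) (𝓝[G] θ₀) (𝓝 θ₀) := tendsto_id'.2 nhdsWithin_le_nhds
    have hg0 : Tendsto g (𝓝[G] θ₀) (𝓝 (g θ₀)) :=
      (hg.continuousAt (hI.mem_nhds hθ₀)).tendsto.mono_left nhdsWithin_le_nhds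
    have hK0 : Tendsto K (𝓝[G] θ₀) (𝓝 (K θ₀)) :=
      (hK.continuousAt (hI.mem_nhds hθ₀)).tendsto.mono_left nhdsWithin_le_nhds
    have hΦζ : ∀ ζ : E, Tendsto (fun θ => K θ - Φ (θ, g θ, ζ)) (𝓝[G] θ₀)
        (𝓝 (K θ₀ - Φ (θ₀, g θ₀, ζ))) := fun ζ =>
      hK0.sub ((hΦ.tendsto _).comp (hid.prodMk_nhds (hg0.prodMk_nhds tendsto_const_nhds)))
    have hbound : ∀ ζ : E, ∀ᶠ θ in 𝓝[G] θ₀, c * ‖ξ θ - ζ‖ ≤ ‖K θ - Φ (θ, g θ, ζ)‖ := fun ζ => by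
      filter_upwards [self_mem_nhdsWithin] with θ hθ
      rw [hθ.2]
      exact norm_mul_le_of_le_inner (hmono _ _ _ _)
    -- coercivity confines `ξ` to a compact set
    obtain ⟨M, hM⟩ : ∃ M : ℝ, ∀ᶠ θ in 𝓝[G] θ₀, ξ θ ∈ Metric.closedBall (0 : E) M := by
      refine ⟨(‖K θ₀ - Φ (θ₀, g θ₀, 0)‖ + 1) / c, ?_⟩
      filter_upwards [hbound 0, (hΦζ 0).norm.eventually_lt_const (lt_add_one _)] with θ h1 h2
      rw [mem_closedBall_zero_iff, le_div_iff₀ hc]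
      rw [sub_zero] at h1
      linarith
    obtain ⟨ξ₀, -, hξ₀⟩ := (isCompact_closedBall (0 : E) M).exists_mapClusterPt
      (tendsto_principal.2 hM)
    obtain ⟨U, hU, hUξ⟩ := mapClusterPt_iff_ultrafilter.1 hξ₀
    have hval : K θ₀ = Φ (θ₀, g θ₀, ξ₀) := by
      have h1 : Tendsto (fun θ => Φ (θ, g θ, ξ θ)) U (𝓝 (Φ (θ₀, g θ₀, ξ₀))) :=
        (hΦ.tendsto _).comp ((hid.mono_left hU).prodMk_nhds ((hg0.mono_left hU).prodMk_nhds hUξ))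
      refine tendsto_nhds_unique (hK0.mono_left hU) (h1.congr' ?_)
      filter_upwards [hU self_mem_nhdsWithin] with θ hθ using hθ.2.symm
    refine ⟨ξ₀, ?_⟩
    have h1 := (hΦζ ξ₀).norm
    rw [hval, sub_self, norm_zero] at h1
    have h2 : Tendsto (fun θ => c⁻¹ * ‖K θ - Φ (θ, g θ, ξ₀)‖) (𝓝[G] θ₀) (𝓝 0) := by
      simpa using h1.const_mul c⁻¹
    refine tendsto_iff_norm_sub_tendsto_zero.2
      (squeeze_zero' (Eventually.of_forall fun _ => norm_nonneg _) ?_ h2)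
    filter_upwards [hbound ξ₀] with θ hθ
    rw [← div_eq_inv_mul, le_div_iff₀ hc]
    linarith
  refine ⟨extendFrom G ξ, continuousOn_extendFrom hdense hlim, ?_⟩
  filter_upwards [heq] with θ h hθ
  have hθG : θ ∈ G := ⟨hθ, h hθ⟩
  obtain ⟨y, hy⟩ := hlim θ hθ
  rw [extendFrom_eq (hdense hθ) hy]
  exact tendsto_nhds_unique (tendsto_pure_nhds ξ θ) (hy.mono_left (pure_le_nhdsWithin hθG))

/-- A function which is differentiable at every point of an interval, with derivative zero almost
everywhere, is constant. -/
theorem eq_of_hasDerivAt_of_ae_zero {E : Type*} [NormedAddCommGroup E] [NormedSpace ℝ E]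
    [CompleteSpace E] {f : ℝ → E} {a b : ℝ} (hf : ∀ t ∈ Ioo a b, DifferentiableAt ℝ f t)
    (h0 : ∀ᵐ t, t ∈ Ioo a b → HasDerivAt f 0 t) {s t : ℝ} (hs : s ∈ Ioo a b) (ht : t ∈ Ioo a b) :
    f t = f s := by
  have hsub : uIcc s t ⊆ Ioo a b := (convex_Ioo a b).ordConnected.uIcc_subset hs ht
  have hae : ∀ᵐ x, x ∈ uIoc s t → deriv f x = 0 := by
    filter_upwards [h0] with x hx hx' using (hx (hsub (uIoc_subset_uIcc hx'))).deriv
  have hint : IntervalIntegrable (deriv f) volume s t := by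
    refine (intervalIntegrable_const (c := (0 : E))).congr_ae ?_
    refine (ae_restrict_iff' measurableSet_uIoc).2 ?_
    filter_upwards [hae] with x hx hx' using (hx hx').symm
  have h1 := intervalIntegral.integral_eq_sub_of_hasDerivAt
    (fun x hx => (hf x (hsub hx)).hasDerivAt) hint
  rw [intervalIntegral.integral_zero_ae hae] at h1
  exact (sub_eq_zero.1 h1.symm)

/-- The equation `g'' = -g`, where `g''` exists everywhere but the equation is only known almost
everywhere: the functions `cos t g - sin t g'` and `sin t g + cos t g'` are constant. -/
theorem eq_cos_add_sin_of_ae {E : Type*} [NormedAddCommGroup E] [NormedSpace ℝ E]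
    [CompleteSpace E] {g ξ : ℝ → E} {a b : ℝ} (h0 : (0 : ℝ) ∈ Ioo a b)
    (hg : ∀ t ∈ Ioo a b, HasDerivAt g (ξ t) t) (hξ : ∀ t ∈ Ioo a b, DifferentiableAt ℝ ξ t)
    (hae : ∀ᵐ t, t ∈ Ioo a b → HasDerivAt ξ (-g t) t) {t : ℝ} (ht : t ∈ Ioo a b) :
    g t = Real.cos t • g 0 + Real.sin t • ξ 0 := by
  have hP := eq_of_hasDerivAt_of_ae_zero (f := fun t => Real.cos t • g t - Real.sin t • ξ t)
    (fun t ht => (Real.differentiableAt_cos.smul (hg t ht).differentiableAt).sub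
      (Real.differentiableAt_sin.smul (hξ t ht))) (by
    filter_upwards [hae] with t h ht
    refine (((Real.hasDerivAt_cos t).smul (hg t ht)).sub
      ((Real.hasDerivAt_sin t).smul (h ht))).congr_deriv ?_
    module) h0 ht
  have hQ := eq_of_hasDerivAt_of_ae_zero (f := fun t => Real.sin t • g t + Real.cos t • ξ t)
    (fun t ht => (Real.differentiableAt_sin.smul (hg t ht).differentiableAt).add
      (Real.differentiableAt_cos.smul (hξ t ht))) (by
    filter_upwards [hae] with t h ht
    refine (((Real.hasDerivAt_sin t).smul (hg t ht)).add
      ((Real.hasDerivAt_cos t).smul (h ht))).congr_deriv ?_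
    module) h0 ht
  simp only [Real.cos_zero, Real.sin_zero, one_smul, zero_smul, sub_zero, zero_add] at hP hQ
  rw [← hP, ← hQ]
  have h1 : g t = (Real.sin t ^ 2 + Real.cos t ^ 2) • g t := by
    rw [Real.sin_sq_add_cos_sq, one_smul]
  nth_rw 1 [h1]
  module

section Flux

variable {m : ℕ} {A : Plane → Mat m → Mat m} {ν : ℝ}

/-- The divergence `∂A_{pq}/∂x_q` at `(x, F)`, taken with `F` held fixed. -/
noncomputable def divX (A : Plane → Mat m → Mat m) (x : Plane) (F : Mat m) :
    EuclideanSpace ℝ (Fin m) :=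
  WithLp.toLp 2 fun p => partialX A 0 x F p 0 + partialX A 1 x F p 1

theorem divX_eq (A : Plane → Mat m → Mat m) (x : Plane) (F : Mat m) (θ : ℝ) :
    divX A x F =
      radialPart θ (Real.cos θ • partialX A 0 x F + Real.sin θ • partialX A 1 x F) +
      angularPart θ (-Real.sin θ • partialX A 0 x F + Real.cos θ • partialX A 1 x F) := by
  ext p
  simp only [divX, PiLp.add_apply, radialPart_apply, angularPart_apply, Pi.add_apply,
    Pi.smul_apply, smul_eq_mul]
  linear_combination -(partialX A 0 x F p 0 + partialX A 1 x F p 1) * Real.sin_sq_add_cos_sq θ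

/-- If the equation holds along a circle of radius `R`, then `ξ = g'` is differentiable, and
`ξ' + g` is controlled by the explicit dependence of `A` on `x`. -/
theorem exists_hasDerivAt_of_flux (hν : 0 < ν) (hA : IsEllipticWith A ν) (hC1 : IsC1InGradient A)
    (hx : HasContinuousSpatialDerivatives A) {g ξ : ℝ → EuclideanSpace ℝ (Fin m)} {R θ : ℝ}
    (hR : R ∈ Ioo (0 : ℝ) 1) (hg : HasDerivAt g (ξ θ) θ)
    (hk : HasDerivAt (fun t => angularPart t (A (polarPoint R t) (polarGrad t (g t) (ξ t))))
      (-(radialPart θ (A (polarPoint R θ) (polarGrad θ (g θ) (ξ θ))) +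
        R • radialPart θ (Real.cos θ • partialX A 0 (polarPoint R θ) (polarGrad θ (g θ) (ξ θ)) +
          Real.sin θ • partialX A 1 (polarPoint R θ) (polarGrad θ (g θ) (ξ θ))))) θ) :
    ∃ w, HasDerivAt ξ w θ ∧
      ν * ‖w + g θ‖ ≤ ‖R • divX A (polarPoint R θ) (polarGrad θ (g θ) (ξ θ))‖ := by
  set x := polarPoint R θ with hx₀
  set F := polarGrad θ (g θ) (ξ θ) with hF₀
  have hxB : ∀ t, polarPoint R t ∈ unitDisc \ {0} := fun t => polarPoint_mem_unitDisc hR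
  -- the acoustic tensor in the direction `e_θ` is invertible
  let T : EuclideanSpace ℝ (Fin m) →ₗ[ℝ] EuclideanSpace ℝ (Fin m) :=
    { toFun := fun v => angularPart θ (fderiv ℝ (A x) F (polarGrad θ 0 v))
      map_add' := fun v v' => by
        rw [← angularPart_add, ← map_add, ← polarGrad_add, add_zero]
      map_smul' := fun c v => by
        rw [RingHom.id_apply, ← angularPart_smul, ← map_smul, ← polarGrad_smul, smul_zero] }
  have hT : ∀ v, ν * ‖v‖ ≤ ‖T v‖ := fun v =>
    norm_mul_le_of_le_inner (hA.le_inner_fderiv (hxB θ).1 F θ v)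
  have hTinj : Function.Injective T := by
    refine (injective_iff_map_eq_zero T).2 fun v hv => ?_
    have h1 := hT v
    rw [hv, norm_zero] at h1
    have h2 : ‖v‖ = 0 := le_antisymm (by nlinarith [norm_nonneg v]) (norm_nonneg v)
    exact norm_eq_zero.1 h2
  obtain ⟨v, hv⟩ := (LinearMap.injective_iff_surjective.1 hTinj) (-(R • divX A x F))
  refine ⟨v - g θ, ?_, ?_⟩
  swap
  · have h1 := hT v
    rw [hv, norm_neg] at h1
    rwa [sub_add_cancel]
  set w := v - g θ with hw
  set ζ : ℝ → EuclideanSpace ℝ (Fin m) := fun t => ξ θ + (t - θ) • w with hζ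
  have hζθ : ζ θ = ξ θ := by simp [hζ]
  have hζd : HasDerivAt ζ w θ := by
    have h1 := (((hasDerivAt_id θ).sub_const θ).smul_const w).const_add (ξ θ)
    rw [one_smul] at h1
    exact h1
  have hFd := hasDerivAt_polarGrad hg hζd
  have hAd := hasDerivAt_coeff_curve (A := A) hC1 hx ((Real.hasDerivAt_cos θ).const_mul R)
    ((Real.hasDerivAt_sin θ).const_mul R) hFd (hxB θ)
  have hkd := hasDerivAt_angularPart hAd
  -- the affine competitor `ζ` has the same flux as `ξ` to first order
  have hdiff : HasDerivAt (fun t =>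
      angularPart t (A (polarPoint R t) (polarGrad t (g t) (ξ t))) -
        angularPart t (A (polarPoint R t) (polarGrad t (g t) (ζ t)))) 0 θ := by
    refine (hk.sub hkd).congr_deriv ?_
    change _ - (angularPart θ ((R * -Real.sin θ) • partialX A 0 x (polarGrad θ (g θ) (ζ θ)) +
      (R * Real.cos θ) • partialX A 1 x (polarGrad θ (g θ) (ζ θ)) +
      fderiv ℝ (A x) (polarGrad θ (g θ) (ζ θ)) (polarGrad θ (ξ θ - ζ θ) (g θ + w))) -
      radialPart θ (A x (polarGrad θ (g θ) (ζ θ)))) = 0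
    rw [hζθ, ← hF₀, sub_self, hw, add_sub_cancel, angularPart_add]
    have h2 : angularPart θ (fderiv ℝ (A x) F (polarGrad θ 0 v)) = -(R • divX A x F) := hv
    rw [h2, divX_eq A x F θ, mul_smul, mul_smul, ← smul_add, angularPart_smul]
    module
  have hle : ∀ t, ‖ξ t - ζ t‖ ≤ ν⁻¹ * ‖angularPart t (A (polarPoint R t)
      (polarGrad t (g t) (ξ t))) - angularPart t (A (polarPoint R t)
        (polarGrad t (g t) (ζ t)))‖ := fun t => by
    rw [← div_eq_inv_mul, le_div_iff₀ hν, mul_comm]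
    exact norm_mul_le_of_le_inner (hA.le_inner_sub hC1 (hxB t).1 t (g t) (ξ t) (ζ t))
  have ho := hdiff.isLittleO
  simp only [hζθ, sub_self, sub_zero, smul_zero] at ho
  have ho2 : (fun t => ξ t - ζ t) =o[𝓝 θ] fun t => t - θ :=
    (Asymptotics.IsBigO.of_bound ν⁻¹ (Eventually.of_forall hle)).trans_isLittleO ho
  refine hasDerivAt_iff_isLittleO.2 (ho2.congr_left fun t => ?_)
  simp only [hζ]
  abel

end Flux

/-! ### The equation on a circle -/

theorem integrable_mul_of_tsupport_subset {X : Type*} [TopologicalSpace X] [T2Space X]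
    [MeasurableSpace X] [OpensMeasurableSpace X] {μ : Measure X} [IsFiniteMeasureOnCompacts μ]
    {f ψ : X → ℝ} {U : Set X} (hf : ContinuousOn f U) (hψ : Continuous ψ)
    (hc : HasCompactSupport ψ) (hs : tsupport ψ ⊆ U) : Integrable (fun x => f x * ψ x) μ := by
  have h1 : IntegrableOn (fun x => f x * ψ x) (tsupport ψ) μ :=
    ((hf.mono hs).mul hψ.continuousOn).integrableOn_compact hc
  refine (integrableOn_iff_integrable_of_support_subset fun x hx => ?_).1 h1
  exact subset_tsupport _ (right_ne_zero_of_mul hx)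

theorem continuousAt_mul_of_tsupport_subset {X : Type*} [TopologicalSpace X]
    {f ψ : X → ℝ} {U : Set X} (hU : IsOpen U) (hf : ContinuousOn f U) (hψ : Continuous ψ)
    {C : Set X} (hC : IsClosed C) (hCψ : Function.support ψ ⊆ C) {x : X} (hx : x ∈ C → x ∈ U) :
    ContinuousAt (fun x => f x * ψ x) x := by
  by_cases h : x ∈ C
  · exact (hf.continuousAt (hU.mem_nhds (hx h))).mul hψ.continuousAt
  · refine (continuousAt_const (y := (0 : ℝ))).congr ?_
    filter_upwards [hC.isOpen_compl.mem_nhds h] with y hy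
    rw [Function.notMem_support.1 fun h' => hy (hCψ h'), mul_zero]

/-- Integration by parts in the radius against a test function. -/
theorem integral_radius_mul_deriv {r r' β : ℝ → ℝ} (hr : ∀ R ∈ Ioo (0 : ℝ) 1, HasDerivAt r (r' R) R)
    (hr' : ContinuousOn r' (Ioo 0 1)) (hβ : ContDiff ℝ ∞ β) (hβc : HasCompactSupport β)
    (hβs : tsupport β ⊆ Ioo 0 1) :
    ∫ R in Ioo (0 : ℝ) 1, R * r R * deriv β R = -∫ R in Ioo (0 : ℝ) 1, (r R + R * r' R) * β R := by
  have hrc : ContinuousOn r (Ioo 0 1) := fun R hR => (hr R hR).continuousAt.continuousWithinAt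
  have hd : ∀ R, HasDerivAt β (deriv β R) R := fun R =>
    (hβ.differentiable (by simp) R).hasDerivAt
  have i1 : Integrable (fun R => R * r R * deriv β R) :=
    integrable_mul_of_tsupport_subset (continuousOn_id.mul hrc) (hβ.continuous_deriv (by simp))
      hβc.deriv ((tsupport_deriv_subset (f := β)).trans hβs)
  have i2 : Integrable (fun R => (r R + R * r' R) * β R) :=
    integrable_mul_of_tsupport_subset (hrc.add (continuousOn_id.mul hr')) hβ.continuous hβc hβs
  have hH : ∀ R, HasDerivAt (fun R => R * r R * β R)
      (R * r R * deriv β R + (r R + R * r' R) * β R) R := fun R => by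
    by_cases h : R ∈ tsupport β
    · refine (((hasDerivAt_id R).mul (hr R (hβs h))).mul (hd R)).congr_deriv ?_
      simp
      ring
    · have h0 := notMem_tsupport_iff_eventuallyEq.1 h
      have h1 : deriv β R = 0 := image_eq_zero_of_notMem_tsupport fun h' =>
        h (tsupport_deriv_subset h')
      rw [h1, image_eq_zero_of_notMem_tsupport h, mul_zero, mul_zero, add_zero]
      refine (hasDerivAt_const R (0 : ℝ)).congr_of_eventuallyEq ?_
      filter_upwards [h0] with y hy
      simp [hy]
  have key := intervalIntegral.integral_eq_sub_of_hasDerivAt (a := 0) (b := 1)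
    (fun R _ => hH R) (i1.add i2).intervalIntegrable
  have hβ1 : β 1 = 0 := image_eq_zero_of_notMem_tsupport fun h => lt_irrefl _ (hβs h).2
  rw [hβ1, intervalIntegral.integral_of_le zero_le_one, integral_Ioc_eq_integral_Ioo,
    integral_add i1.integrableOn i2.integrableOn] at key
  linarith

/-- A continuous weak solution of `R ∂r/∂R + r + ∂q/∂θ = 0` solves the equation on each circle. -/
theorem hasDerivAt_angular_of_weak {r r' q : ℝ × ℝ → ℝ}
    (hr : ∀ p ∈ polarRect, HasDerivAt (fun R => r (R, p.2)) (r' p) p.1)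
    (hrc : ContinuousOn r polarRect) (hr'c : ContinuousOn r' polarRect)
    (hqc : ContinuousOn q polarRect)
    (hw : ∀ ψ, IsPolarTest ψ → ∫ p in polarRect, (p.1 * r p * fderiv ℝ ψ p (1, 0) +
      q p * fderiv ℝ ψ p (0, 1)) = 0) {p : ℝ × ℝ} (hp : p ∈ polarRect) :
    HasDerivAt (fun θ => q (p.1, θ)) (-(r p + p.1 * r' p)) p.2 := by
  set b : ℝ × ℝ → ℝ := fun p => r p + p.1 * r' p with hb
  have hbc : ContinuousOn b polarRect := hrc.add (continuousOn_fst.mul hr'c)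
  set I := Ioo (-Real.pi) Real.pi with hI
  have slice1 : ∀ {f : ℝ × ℝ → ℝ}, ContinuousOn f polarRect → ∀ θ ∈ I,
      ContinuousOn (fun R => f (R, θ)) (Ioo 0 1) := fun hf θ hθ =>
    hf.comp (by fun_prop) fun R hR => ⟨hR, hθ⟩
  have slice2 : ∀ {f : ℝ × ℝ → ℝ}, ContinuousOn f polarRect → ∀ R ∈ Ioo (0 : ℝ) 1,
      ContinuousOn (fun θ => f (R, θ)) I := fun hf R hR =>
    hf.comp (by fun_prop) fun θ hθ => ⟨hR, hθ⟩
  -- the weak equation in the angle, at every radius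
  have step : ∀ η : ℝ → ℝ, ContDiff ℝ ∞ η → HasCompactSupport η → tsupport η ⊆ I →
      ∀ R ∈ Ioo (0 : ℝ) 1, ∫ θ in I, (q (R, θ) * deriv η θ - b (R, θ) * η θ) = 0 := by
    intro η hη hηc hηs
    have hη' : Continuous (deriv η) := hη.continuous_deriv (by simp)
    have hηs' : tsupport (deriv η) ⊆ I := (tsupport_deriv_subset (f := η)).trans hηs
    set N : ℝ → ℝ := fun R => ∫ θ in I, (q (R, θ) * deriv η θ - b (R, θ) * η θ) with hN
    have hNc : ContinuousOn N (Ioo 0 1) := by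
      refine continuousOn_integral_of_compact_support (k := tsupport η) hηc ?_ ?_
      · intro z hz
        have c1 : ContinuousAt (fun z : ℝ × ℝ => q z * deriv η z.2) z := by
          refine continuousAt_mul_of_tsupport_subset isOpen_polarRect hqc
            (hη'.comp continuous_snd) ((isClosed_tsupport (deriv η)).preimage continuous_snd)
            (fun y hy => subset_tsupport _ hy) fun h => ⟨hz.1, hηs' h⟩
        have c2 : ContinuousAt (fun z : ℝ × ℝ => b z * η z.2) z := by
          refine continuousAt_mul_of_tsupport_subset isOpen_polarRect hbc
            (hη.continuous.comp continuous_snd) ((isClosed_tsupport η).preimage continuous_snd)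
            (fun y hy => subset_tsupport _ hy) fun h => ⟨hz.1, hηs h⟩
        exact (c1.sub c2).continuousWithinAt
      · intro R θ _ hθ
        rw [image_eq_zero_of_notMem_tsupport hθ, image_eq_zero_of_notMem_tsupport fun h' =>
          hθ (tsupport_deriv_subset h')]
        simp
    have hN0 : ∀ᵐ R, R ∈ Ioo (0 : ℝ) 1 → N R = 0 := by
      refine isOpen_Ioo.ae_eq_zero_of_integral_contDiff_smul_eq_zero
        (hNc.locallyIntegrableOn measurableSet_Ioo) fun β hβ hβc hβs => ?_
      have ht := IsPolarTest.prod hβ hβc hβs hη hηc hηs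
      have h1 := hw _ ht
      have hβ' : Continuous (deriv β) := hβ.continuous_deriv (by simp)
      have hβs' : tsupport (deriv β) ⊆ Ioo 0 1 := (tsupport_deriv_subset (f := β)).trans hβs
      have f1 : ∀ p : ℝ × ℝ, fderiv ℝ (fun p : ℝ × ℝ => β p.1 * η p.2) p (1, 0) =
          deriv β p.1 * η p.2 := fun p =>
        (ht.hasDerivAt_fst p.1 p.2).unique
          (((hβ.differentiable (by simp) p.1).hasDerivAt).mul_const (η p.2))
      have f2 : ∀ p : ℝ × ℝ, fderiv ℝ (fun p : ℝ × ℝ => β p.1 * η p.2) p (0, 1) =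
          β p.1 * deriv η p.2 := fun p =>
        (ht.hasDerivAt_snd p.1 p.2).unique
          (((hη.differentiable (by simp) p.2).hasDerivAt).const_mul (β p.1))
      simp_rw [f1, f2] at h1
      have iprod : ∀ {f : ℝ × ℝ → ℝ} {u v : ℝ → ℝ}, ContinuousOn f polarRect → Continuous u →
          Continuous v → HasCompactSupport u → HasCompactSupport v → tsupport u ⊆ Ioo 0 1 →
          tsupport v ⊆ I → IntegrableOn (fun p : ℝ × ℝ => f p * (u p.1 * v p.2)) polarRect := by
        intro f u v hf hu hv huc hvc hus hvs
        have hsub : Function.support (fun p : ℝ × ℝ => u p.1 * v p.2) ⊆ tsupport u ×ˢ tsupport v :=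
          fun p hp => ⟨subset_tsupport _ (left_ne_zero_of_mul hp),
            subset_tsupport _ (right_ne_zero_of_mul hp)⟩
        exact (integrable_mul_of_tsupport_subset hf
          ((hu.comp continuous_fst).mul (hv.comp continuous_snd))
          (HasCompactSupport.of_support_subset_isCompact (huc.prod hvc) hsub)
          ((closure_minimal hsub (huc.prod hvc).isClosed).trans
            (prod_mono hus hvs))).integrableOn
      have j1 := iprod (f := fun p => p.1 * r p) (continuousOn_fst.mul hrc) hβ' hη.continuous
        hβc.deriv hηc hβs' hηs
      have j2 := iprod hqc hβ.continuous hη' hβc hηc.deriv hβs hηs'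
      have j3 := iprod hbc hβ.continuous hη.continuous hβc hηc hβs hηs
      have h2 : ∫ p in polarRect, p.1 * r p * (deriv β p.1 * η p.2) =
          -∫ p in polarRect, b p * (β p.1 * η p.2) := by
        rw [setIntegral_polarRect_symm j1, setIntegral_polarRect_symm j3, ← integral_neg]
        refine setIntegral_congr_fun measurableSet_Ioo fun θ hθ => ?_
        have h3 := integral_radius_mul_deriv (r := fun R => r (R, θ)) (r' := fun R => r' (R, θ))
          (fun R hR => hr (R, θ) ⟨hR, hθ⟩) (slice1 hr'c θ hθ) hβ hβc hβs
        simp only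
        have e1 : ∀ R, R * r (R, θ) * (deriv β R * η θ) = R * r (R, θ) * deriv β R * η θ :=
          fun R => by ring
        have e2 : ∀ R, b (R, θ) * (β R * η θ) = (r (R, θ) + R * r' (R, θ)) * β R * η θ :=
          fun R => by simp only [hb]; ring
        simp_rw [e1, e2]
        rw [integral_mul_const, integral_mul_const, h3]
        ring
      rw [integral_add j1 j2, h2, neg_add_eq_sub, ← integral_sub j2 j3] at h1
      have j4 : IntegrableOn (fun p : ℝ × ℝ => q p * (β p.1 * deriv η p.2) -
        b p * (β p.1 * η p.2)) polarRect := j2.sub j3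
      rw [setIntegral_polarRect j4] at h1
      rw [← h1, ← setIntegral_eq_integral_of_forall_compl_eq_zero (s := Ioo (0 : ℝ) 1)
        fun R hR => by
          rw [image_eq_zero_of_notMem_tsupport fun h' => hR (hβs h'), zero_smul]]
      refine integral_congr_ae (ae_of_all _ fun R => ?_)
      simp only [hN, smul_eq_mul]
      rw [← integral_const_mul]
      refine integral_congr_ae (ae_of_all _ fun θ => ?_)
      simp only
      ring
    have h0 : EqOn N (fun _ => 0) (Ioo 0 1) := by
      refine Measure.eqOn_open_of_ae_eq (μ := volume)
        ((ae_restrict_iff' measurableSet_Ioo).2 hN0) isOpen_Ioo hNc continuousOn_const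
    exact fun R hR => h0 hR
  -- pass to an angular interval compactly contained in `I`
  obtain ⟨R, θ₀⟩ := p
  obtain ⟨hR, hθ₀⟩ : R ∈ Ioo (0 : ℝ) 1 ∧ θ₀ ∈ I := hp
  obtain ⟨a, ha1, ha2⟩ := exists_between hθ₀.1
  obtain ⟨c, hc1, hc2⟩ := exists_between hθ₀.2
  have hsub : Icc a c ⊆ I := fun t ht => ⟨ha1.trans_le ht.1, ht.2.trans_lt hc2⟩
  have hac : a < c := ha2.trans hc1
  have hq1 := (slice2 hqc R hR)
  have hb1 := (slice2 hbc R hR)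
  have hqi : IntegrableOn (fun θ => q (R, θ)) (Ioo a c) :=
    ((hq1.mono hsub).integrableOn_compact isCompact_Icc).mono_set Ioo_subset_Icc_self
  have hbi : IntegrableOn (fun θ => -b (R, θ)) (Ioo a c) :=
    ((hb1.mono hsub).neg.integrableOn_compact isCompact_Icc).mono_set Ioo_subset_Icc_self
  obtain ⟨k, hk⟩ := ae_eq_primitive_of_integral_mul_deriv (c := θ₀) hac ⟨ha2.le, hc1.le⟩ hqi hbi
    fun η hη hηc hηs => by
      have hηI : tsupport η ⊆ I := hηs.trans (Ioo_subset_Icc_self.trans hsub)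
      have h1 := step η hη hηc hηI R hR
      have i1 : Integrable (fun θ => q (R, θ) * deriv η θ) :=
        integrable_mul_of_tsupport_subset hq1 (hη.continuous_deriv (by simp)) hηc.deriv
          ((tsupport_deriv_subset (f := η)).trans hηI)
      have i2 : Integrable (fun θ => b (R, θ) * η θ) :=
        integrable_mul_of_tsupport_subset hb1 hη.continuous hηc hηI
      rw [integral_sub i1.integrableOn i2.integrableOn] at h1
      have z1 : ∀ {f : ℝ → ℝ} {S : Set ℝ}, tsupport η ⊆ S →
          ∫ θ in S, f θ * deriv η θ = ∫ θ, f θ * deriv η θ := fun hS =>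
        setIntegral_eq_integral_of_forall_compl_eq_zero fun θ hθ => by
          rw [image_eq_zero_of_notMem_tsupport fun h' => hθ (hS (tsupport_deriv_subset h')),
            mul_zero]
      have z2 : ∀ {f : ℝ → ℝ} {S : Set ℝ}, tsupport η ⊆ S →
          ∫ θ in S, f θ * η θ = ∫ θ, f θ * η θ := fun hS =>
        setIntegral_eq_integral_of_forall_compl_eq_zero fun θ hθ => by
          rw [image_eq_zero_of_notMem_tsupport fun h' => hθ (hS h'), mul_zero]
      rw [z1 hηI, z2 hηI] at h1
      rw [z1 hηs, z2 hηs]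
      simp_rw [neg_mul]
      rw [integral_neg, neg_neg]
      linarith
  have hderiv : ∀ t ∈ Ioo a c, HasDerivAt (fun t => k + ∫ s in θ₀..t, -b (R, s)) (-b (R, t)) t := by
    intro t ht
    have hcont : ContinuousOn (fun θ => -b (R, θ)) (Ioo a c) :=
      (hb1.mono (Ioo_subset_Icc_self.trans hsub)).neg
    refine (intervalIntegral.integral_hasDerivAt_right ?_
      (hcont.stronglyMeasurableAtFilter isOpen_Ioo t ht)
      (hcont.continuousAt (isOpen_Ioo.mem_nhds ht))).const_add k
    refine ContinuousOn.intervalIntegrable (hb1.neg.mono ?_)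
    exact ((convex_Ioo a c).ordConnected.uIcc_subset ⟨ha2, hc1⟩ ht).trans
      (Ioo_subset_Icc_self.trans hsub)
  have heq : EqOn (fun θ => q (R, θ)) (fun t => k + ∫ s in θ₀..t, -b (R, s)) (Ioo a c) :=
    Measure.eqOn_open_of_ae_eq (μ := volume) ((ae_restrict_iff' measurableSet_Ioo).2 hk) isOpen_Ioo
      (hq1.mono (Ioo_subset_Icc_self.trans hsub))
      fun t ht => (hderiv t ht).continuousAt.continuousWithinAt
  refine (hderiv θ₀ ⟨ha2, hc1⟩).congr_of_eventuallyEq ?_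
  filter_upwards [isOpen_Ioo.mem_nhds (show θ₀ ∈ Ioo a c from ⟨ha2, hc1⟩)] with t ht using heq ht

/-! ### The equation in polar coordinates -/

section Equation

variable {m : ℕ} {A : Plane → Mat m → Mat m} {Du : Plane → Mat m}

/-- The weak form of the equation in polar coordinates: `∂(R a e_R)/∂R + ∂(a e_θ)/∂θ = 0` with
`a = A(x, ∇u)`. -/
theorem IsDistributionalSolution.polar (hsol : IsDistributionalSolution A Du) (p₀ : Fin m)
    {ψ : ℝ × ℝ → ℝ} (hψ : IsPolarTest ψ) :
    ∫ p in polarRect,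
      (p.1 * radialPart p.2 (A (polarPoint p.1 p.2) (Du (polarPoint p.1 p.2))) p₀ *
          fderiv ℝ ψ p (1, 0) +
        angularPart p.2 (A (polarPoint p.1 p.2) (Du (polarPoint p.1 p.2))) p₀ *
          fderiv ℝ ψ p (0, 1)) = 0 := by
  set c : EuclideanSpace ℝ (Fin m) := EuclideanSpace.single p₀ 1 with hc
  have hφ := polarTest_contDiff hψ.1 hψ.2 hψ.3
  have hsupp : Function.support (fun x => polarTest ψ x • c) ⊆ Function.support (polarTest ψ) :=
    fun x hx h => hx (show polarTest ψ x • c = 0 by rw [h, zero_smul])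
  have h := hsol.equation (fun x => polarTest ψ x • c)
    ((hφ.of_le (by simp)).smul contDiff_const)
    ((polarTest_hasCompactSupport hψ.2 hψ.3).mono hsupp)
    ((closure_mono hsupp).trans (polarTest_tsupport_subset_unitDisc hψ.2 hψ.3))
  have hd : ∀ x v, fderiv ℝ (fun x => polarTest ψ x • c) x v = fderiv ℝ (polarTest ψ) x v • c :=
    fun x v => by
      rw [(((hφ.differentiable (by simp) x).hasFDerivAt).smul_const c).fderiv]
      rfl
  rw [setIntegral_unitDisc_eq_polar] at h
  refine (setIntegral_congr_fun measurableSet_polarRect fun p hp => ?_).trans h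
  obtain ⟨h0, h1⟩ := fderiv_polarTest hψ.1 hψ.2 hψ.3 hp
  simp only [hd, smul_eq_mul]
  rw [Finset.sum_eq_single p₀]
  · rw [Fin.sum_univ_two]
    simp only [PiLp.smul_apply, hc, PiLp.single_apply, if_true, smul_eq_mul, mul_one,
      radialPart_apply, angularPart_apply]
    linear_combination -A (polarPoint p.1 p.2) (Du (polarPoint p.1 p.2)) p₀ 0 * h0 -
      A (polarPoint p.1 p.2) (Du (polarPoint p.1 p.2)) p₀ 1 * h1
  · intro p' _ hp'
    simp [hc, hp']
  · simp

/-- The equation, tested with a fixed function of the radius supported in `(0, 1 / 2)`: the angular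
flux averaged in the radius agrees almost everywhere with a continuous function of the angle. The support
stays away from the unit circle because `A(x, ∇u)` is only locally integrable in the disc, and the
factor `R` is the area element, with which `A(x, ∇u)` is integrable up to `R = 0`. -/
theorem IsDistributionalSolution.exists_continuousOn_average (hsol : IsDistributionalSolution A Du)
    (p₀ : Fin m) {β : ℝ → ℝ} (hβ : ContDiff ℝ ∞ β) (hβc : HasCompactSupport β)
    (hβs : tsupport β ⊆ Ioo 0 (1 / 2)) :
    ∃ K : ℝ → ℝ, ContinuousOn K (Ioo (-Real.pi) Real.pi) ∧
      ∀ᵐ θ, θ ∈ Ioo (-Real.pi) Real.pi → K θ = ∫ R in Ioo (0 : ℝ) 1,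
        R * β R * angularPart θ (A (polarPoint R θ) (Du (polarPoint R θ))) p₀ := by
  have hpi := Real.pi_pos
  set a : ℝ × ℝ → Mat m := fun p => A (polarPoint p.1 p.2) (Du (polarPoint p.1 p.2)) with ha
  have hβ1 : tsupport β ⊆ Ioo 0 1 := hβs.trans (Ioo_subset_Ioo_right (by norm_num))
  have hai : IntegrableOn (fun p : ℝ × ℝ => p.1 • a p)
      (Ioo 0 (1 / 2) ×ˢ Ioo (-Real.pi) Real.pi) := by
    refine integrableOn_polar (f := fun x => A x (Du x)) ?_
    refine ((hsol.locallyIntegrable.integrableOn_compact_subset ?_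
      (isCompact_closedBall (0 : Plane) (1 / 2)))).mono_set Metric.ball_subset_closedBall
    exact Metric.closedBall_subset_ball (by norm_num)
  have haq : ∀ q, IntegrableOn (fun p : ℝ × ℝ => p.1 * a p p₀ q)
      (Ioo 0 (1 / 2) ×ˢ Ioo (-Real.pi) Real.pi) := fun q =>
    ((ContinuousLinearMap.proj (R := ℝ) (φ := fun _ : Fin 2 => ℝ) q).comp
      (ContinuousLinearMap.proj (R := ℝ) (φ := fun _ : Fin m => Fin 2 → ℝ) p₀)).integrable_comp hai
  -- products with a function supported in `(0, 1 / 2)` are integrable on the whole rectangle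
  have hint : ∀ (q : Fin 2) (c : ℝ × ℝ → ℝ), Continuous c →
      (∀ p : ℝ × ℝ, p.1 ∉ Ioo (0 : ℝ) (1 / 2) → c p = 0) →
      IntegrableOn (fun p : ℝ × ℝ => p.1 * a p p₀ q * c p) polarRect := fun q c hc hc0 => by
    have h1 : IntegrableOn (fun p : ℝ × ℝ => p.1 * a p p₀ q * c p)
        (Ioo 0 (1 / 2) ×ˢ Ioo (-Real.pi) Real.pi) := by
      obtain ⟨C, hC⟩ := (isCompact_Icc.prod isCompact_Icc :
        IsCompact (Icc (0 : ℝ) (1 / 2) ×ˢ Icc (-Real.pi) Real.pi)).exists_bound_of_continuousOn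
          hc.continuousOn
      refine (haq q).mul_bdd (c := C) hc.aestronglyMeasurable ?_
      refine (ae_restrict_iff' (measurableSet_Ioo.prod measurableSet_Ioo)).2
        (ae_of_all _ fun p hp => hC p ?_)
      exact ⟨Ioo_subset_Icc_self hp.1, Ioo_subset_Icc_self hp.2⟩
    refine h1.of_forall_sdiff_eq_zero measurableSet_polarRect fun p hp => ?_
    rw [hc0 p fun h => hp.2 ⟨h, hp.1.2⟩, mul_zero]
  set γ : ℝ → ℝ := fun R => R * β R with hγ
  have hγd : ContDiff ℝ ∞ γ := contDiff_id.mul hβ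
  have hγsub : tsupport γ ⊆ tsupport β := tsupport_mul_subset_right (f := fun R : ℝ => R) (g := β)
  have hγc : HasCompactSupport γ := hβc.mul_left
  have hdγ : Continuous (deriv γ) := hγd.continuous_deriv (by simp)
  have hβ0 : ∀ R, R ∉ Ioo (0 : ℝ) (1 / 2) → β R = 0 := fun R hR =>
    image_eq_zero_of_notMem_tsupport fun h => hR (hβs h)
  have hγ0 : ∀ R, R ∉ Ioo (0 : ℝ) (1 / 2) → deriv γ R = 0 := fun R hR =>
    image_eq_zero_of_notMem_tsupport fun h => hR (hβs (hγsub (tsupport_deriv_subset h)))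
  have iK : IntegrableOn (fun p : ℝ × ℝ => γ p.1 * angularPart p.2 (a p) p₀) polarRect := by
    have cβ := hβ.continuous
    have h1 := (hint 1 (fun p => β p.1 * Real.cos p.2) (by fun_prop)
      (fun p hp => by rw [hβ0 _ hp, zero_mul])).sub (hint 0 (fun p => β p.1 * Real.sin p.2)
        (by fun_prop) (fun p hp => by rw [hβ0 _ hp, zero_mul]))
    refine h1.congr_fun (fun p _ => ?_) measurableSet_polarRect
    simp only [hγ, angularPart_apply, Pi.sub_apply]
    ring
  have iH : IntegrableOn (fun p : ℝ × ℝ => p.1 * radialPart p.2 (a p) p₀ * deriv γ p.1)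
      polarRect := by
    have h1 := (hint 0 (fun p => deriv γ p.1 * Real.cos p.2) (by fun_prop)
      (fun p hp => by rw [hγ0 _ hp, zero_mul])).add (hint 1 (fun p => deriv γ p.1 * Real.sin p.2)
        (by fun_prop) (fun p hp => by rw [hγ0 _ hp, zero_mul]))
    refine h1.congr_fun (fun p _ => ?_) measurableSet_polarRect
    simp only [radialPart_apply, Pi.add_apply]
    ring
  set H : ℝ → ℝ := fun θ => ∫ R in Ioo (0 : ℝ) 1, R * radialPart θ (a (R, θ)) p₀ * deriv γ R with hH
  have iK' : IntegrableOn (fun θ => ∫ R in Ioo (0 : ℝ) 1, γ R * angularPart θ (a (R, θ)) p₀)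
      (Ioo (-Real.pi) Real.pi) := by
    have h := iK
    rw [IntegrableOn, volume_restrict_polarRect] at h
    exact h.integral_prod_right
  have iH' : IntegrableOn H (Ioo (-Real.pi) Real.pi) := by
    have h := iH
    rw [IntegrableOn, volume_restrict_polarRect] at h
    exact h.integral_prod_right
  obtain ⟨k, hk⟩ := ae_eq_primitive_of_integral_mul_deriv (c := 0) (by linarith)
    (by constructor <;> linarith) iK' iH' fun η hη hηc hηs => by
      have ht := IsPolarTest.prod hγd hγc (hγsub.trans hβ1) hη hηc hηs
      have h1 := hsol.polar p₀ ht
      have f1 : ∀ p : ℝ × ℝ, fderiv ℝ (fun p : ℝ × ℝ => γ p.1 * η p.2) p (1, 0) =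
          deriv γ p.1 * η p.2 := fun p =>
        (ht.hasDerivAt_fst p.1 p.2).unique
          (((hγd.differentiable (by simp) p.1).hasDerivAt).mul_const (η p.2))
      have f2 : ∀ p : ℝ × ℝ, fderiv ℝ (fun p : ℝ × ℝ => γ p.1 * η p.2) p (0, 1) =
          γ p.1 * deriv η p.2 := fun p =>
        (ht.hasDerivAt_snd p.1 p.2).unique
          (((hη.differentiable (by simp) p.2).hasDerivAt).const_mul (γ p.1))
      have cη := hη.continuous
      have cη' : Continuous (deriv η) := hη.continuous_deriv (by simp)
      have e : ∀ p : ℝ × ℝ, p.1 * radialPart p.2 (a p) p₀ * (deriv γ p.1 * η p.2) +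
          angularPart p.2 (a p) p₀ * (γ p.1 * deriv η p.2) =
          p.1 * radialPart p.2 (a p) p₀ * deriv γ p.1 * η p.2 +
          γ p.1 * angularPart p.2 (a p) p₀ * deriv η p.2 := fun p => by ring
      have j1 := integrableOn_polarRect_mul iH (cη.comp continuous_snd)
      have j2 := integrableOn_polarRect_mul iK (cη'.comp continuous_snd)
      simp_rw [f1, f2] at h1
      simp only [Function.comp_apply] at j1 j2
      rw [integral_congr_ae (ae_of_all _ e), integral_add j1 j2, setIntegral_polarRect_symm j1,
        setIntegral_polarRect_symm j2] at h1
      simp_rw [integral_mul_const] at h1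
      linarith
  refine ⟨fun θ => k + ∫ s in (0 : ℝ)..θ, H s, ?_, ?_⟩
  · exact continuousOn_const.add ((continuousOn_primitive_of_integrableOn (by linarith)
      (by constructor <;> linarith) iH').mono Ioo_subset_Icc_self)
  · filter_upwards [hk] with θ h hθ using (h hθ).symm

end Equation

/-! ### The averaged flux -/

section Average

variable {m : ℕ} {A : Plane → Mat m → Mat m} {ν : ℝ}

/-- The flux through rays, as a function of the angle and of the two components of the gradient,
averaged in the radius with the weight `R β(R)`. -/
noncomputable def averagedFlux (A : Plane → Mat m → Mat m) (β : ℝ → ℝ)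
    (z : ℝ × EuclideanSpace ℝ (Fin m) × EuclideanSpace ℝ (Fin m)) : EuclideanSpace ℝ (Fin m) :=
  ∫ R, (R * β R) • angularPart z.1 (A (polarPoint R z.1) (polarGrad z.1 z.2.1 z.2.2))

theorem continuous_averagedFlux_integrand (hC1 : IsC1InGradient A)
    (hx : HasContinuousSpatialDerivatives A) {β : ℝ → ℝ} (hβ : Continuous β)
    (hβs : tsupport β ⊆ Ioo 0 1) :
    Continuous fun w : (ℝ × EuclideanSpace ℝ (Fin m) × EuclideanSpace ℝ (Fin m)) × ℝ =>
      (w.2 * β w.2) • angularPart w.1.1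
        (A (polarPoint w.2 w.1.1) (polarGrad w.1.1 w.1.2.1 w.1.2.2)) := by
  refine continuous_iff_continuousAt.2 fun w => ?_
  by_cases h : w.2 ∈ tsupport β
  · have c1 : ContinuousAt (fun w : (ℝ × EuclideanSpace ℝ (Fin m) × EuclideanSpace ℝ (Fin m)) × ℝ =>
        (polarPoint w.2 w.1.1, polarGrad w.1.1 w.1.2.1 w.1.2.2)) w :=
      ((continuous_polarPoint.comp (continuous_snd.prodMk
        (continuous_fst.comp continuous_fst))).prodMk
        (continuous_polarGrad.comp continuous_fst)).continuousAt
    have c2 : ContinuousAt (fun w : (ℝ × EuclideanSpace ℝ (Fin m) × EuclideanSpace ℝ (Fin m)) × ℝ =>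
        A (polarPoint w.2 w.1.1) (polarGrad w.1.1 w.1.2.1 w.1.2.2)) w :=
      (continuousAt_coeff hC1 hx (polarPoint_mem_unitDisc (hβs h))
        (polarGrad w.1.1 w.1.2.1 w.1.2.2)).comp_of_eq c1 rfl
    have c3 : ContinuousAt (fun w : (ℝ × EuclideanSpace ℝ (Fin m) × EuclideanSpace ℝ (Fin m)) × ℝ =>
        angularPart w.1.1 (A (polarPoint w.2 w.1.1) (polarGrad w.1.1 w.1.2.1 w.1.2.2))) w :=
      ContinuousAt.comp (g := fun z : ℝ × Mat m => angularPart z.1 z.2)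
        continuous_angularPart.continuousAt
        ((continuous_fst.comp continuous_fst).continuousAt.prodMk c2)
    exact ((continuous_snd.mul (hβ.comp continuous_snd)).continuousAt).smul c3
  · refine (continuousAt_const (y := (0 : EuclideanSpace ℝ (Fin m)))).congr ?_
    have h1 : ∀ᶠ w' : (ℝ × EuclideanSpace ℝ (Fin m) × EuclideanSpace ℝ (Fin m)) × ℝ in 𝓝 w,
        w'.2 ∉ tsupport β :=
      continuous_snd.continuousAt.eventually ((isClosed_tsupport β).isOpen_compl.mem_nhds h)
    filter_upwards [h1] with w' hw'
    rw [image_eq_zero_of_notMem_tsupport hw', mul_zero, zero_smul]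

theorem integrable_averagedFlux_integrand (hC1 : IsC1InGradient A)
    (hx : HasContinuousSpatialDerivatives A) {β : ℝ → ℝ} (hβ : Continuous β)
    (hβc : HasCompactSupport β) (hβs : tsupport β ⊆ Ioo 0 1)
    (z : ℝ × EuclideanSpace ℝ (Fin m) × EuclideanSpace ℝ (Fin m)) :
    Integrable fun R => (R * β R) •
      angularPart z.1 (A (polarPoint R z.1) (polarGrad z.1 z.2.1 z.2.2)) := by
  refine Continuous.integrable_of_hasCompactSupport
    ((continuous_averagedFlux_integrand hC1 hx hβ hβs).comp
      ((continuous_const (y := z)).prodMk continuous_id)) ?_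
  exact hβc.mono fun R hR h => hR (by simp [h])

theorem continuous_averagedFlux (hC1 : IsC1InGradient A)
    (hx : HasContinuousSpatialDerivatives A) {β : ℝ → ℝ} (hβ : Continuous β)
    (hβc : HasCompactSupport β) (hβs : tsupport β ⊆ Ioo 0 1) :
    Continuous (averagedFlux A β) := by
  rw [← continuousOn_univ]
  refine continuousOn_integral_of_compact_support (k := tsupport β) hβc
    (continuous_averagedFlux_integrand hC1 hx hβ hβs).continuousOn fun z R _ hR => ?_
  rw [image_eq_zero_of_notMem_tsupport hR, mul_zero, zero_smul]

theorem le_inner_averagedFlux_sub (hA : IsEllipticWith A ν) (hC1 : IsC1InGradient A)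
    (hx : HasContinuousSpatialDerivatives A) {β : ℝ → ℝ} (hβ : Continuous β)
    (hβc : HasCompactSupport β) (hβs : tsupport β ⊆ Ioo 0 1) (hβ0 : ∀ R, 0 ≤ β R) (θ : ℝ)
    (g ξ ζ : EuclideanSpace ℝ (Fin m)) :
    ν * (∫ R in Ioo (0 : ℝ) 1, R * β R) * ‖ξ - ζ‖ ^ 2 ≤
      inner ℝ (averagedFlux A β (θ, g, ξ) - averagedFlux A β (θ, g, ζ)) (ξ - ζ) := by
  have i1 := integrable_averagedFlux_integrand hC1 hx hβ hβc hβs (θ, g, ξ)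
  have i2 := integrable_averagedFlux_integrand hC1 hx hβ hβc hβs (θ, g, ζ)
  have hz : ∀ R, R ∉ Ioo (0 : ℝ) 1 → R * β R = 0 := fun R hR => by
    rw [image_eq_zero_of_notMem_tsupport fun h => hR (hβs h), mul_zero]
  have i3 : Integrable fun R => R * β R :=
    (continuous_id.mul hβ).integrable_of_hasCompactSupport hβc.mul_left
  rw [setIntegral_eq_integral_of_forall_compl_eq_zero hz]
  unfold averagedFlux
  rw [← integral_sub' i1 i2, real_inner_comm, ← integral_inner (i1.sub i2), mul_right_comm,
    ← integral_const_mul]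
  refine integral_mono (i3.const_mul _) ((i1.sub i2).const_inner _) fun R => ?_
  simp only [Pi.sub_apply]
  rw [← smul_sub, inner_smul_right, real_inner_comm, mul_comm]
  by_cases hR : R ∈ Ioo (0 : ℝ) 1
  · exact mul_le_mul_of_nonneg_left
      (hA.le_inner_sub hC1 (polarPoint_mem_unitDisc hR).1 θ g ξ ζ) (mul_nonneg hR.1.le (hβ0 R))
  · rw [hz R hR, zero_mul, zero_mul]

theorem averagedFlux_apply (hC1 : IsC1InGradient A)
    (hx : HasContinuousSpatialDerivatives A) {β : ℝ → ℝ} (hβ : Continuous β)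
    (hβc : HasCompactSupport β) (hβs : tsupport β ⊆ Ioo 0 1) (θ : ℝ)
    (g ξ : EuclideanSpace ℝ (Fin m)) (p : Fin m) :
    averagedFlux A β (θ, g, ξ) p = ∫ R in Ioo (0 : ℝ) 1,
      R * β R * angularPart θ (A (polarPoint R θ) (polarGrad θ g ξ)) p := by
  have i1 := integrable_averagedFlux_integrand hC1 hx hβ hβc hβs (θ, g, ξ)
  have h1 := (PiLp.proj 2 (𝕜 := ℝ) (fun _ : Fin m => ℝ) p).integral_comp_comm i1
  rw [setIntegral_eq_integral_of_forall_compl_eq_zero fun R hR => by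
    rw [image_eq_zero_of_notMem_tsupport fun h => hR (hβs h), mul_zero, zero_mul]]
  exact h1.symm

end Average

/-! ### One-homogeneous solutions are linear -/

/-- The radii tending to `0`, up to null sets, form a proper filter. -/
theorem neBot_nhdsGT_inf_ae : (𝓝[>] (0 : ℝ) ⊓ ae volume).NeBot := by
  refine inf_neBot_iff.2 fun s hs t ht => ?_
  obtain ⟨ε, hε, hεs⟩ := mem_nhdsGT_iff_exists_Ioo_subset.1 hs
  by_contra hcon
  have hsub : Ioo 0 ε ⊆ tᶜ := fun x hx hxt => hcon ⟨x, hεs hx, hxt⟩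
  have h0 : volume (Ioo (0 : ℝ) ε) = 0 := measure_mono_null hsub ht
  rw [Real.volume_Ioo, ENNReal.ofReal_eq_zero] at h0
  have : (0 : ℝ) < ε := hε
  linarith

/-- An almost everywhere statement in the polar rectangle, ray by ray. -/
theorem ae_ae_of_ae_polarRect {P : ℝ → ℝ → Prop}
    (h : ∀ᵐ p : ℝ × ℝ, p ∈ polarRect → P p.1 p.2) :
    ∀ᵐ θ : ℝ, θ ∈ Ioo (-Real.pi) Real.pi → ∀ᵐ R : ℝ, R ∈ Ioo (0 : ℝ) 1 → P R θ := by
  have h1 : ∀ᵐ z : ℝ × ℝ, z.swap ∈ polarRect → P z.swap.1 z.swap.2 :=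
    (Measure.measurePreserving_swap (μ := (volume : Measure ℝ))
      (ν := (volume : Measure ℝ))).quasiMeasurePreserving.ae h
  filter_upwards [Measure.ae_ae_of_ae_prod h1] with θ hθ hθI
  filter_upwards [hθ] with R hR hRI using hR ⟨hRI, hθI⟩

/-- The polar structure of a one-homogeneous Sobolev map: `u = R g(θ)`, where `g` is a primitive of
an integrable function `ξ`, and `∇u = g ⊗ e_R + ξ ⊗ e_θ`. -/
theorem exists_polar_structure {m : ℕ} {u : Plane → EuclideanSpace ℝ (Fin m)} {Du : Plane → Mat m}
    (hu : IsW12WithGradient u Du) (hom : IsOneHomogeneous u) :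
    ∃ (k : Fin m → ℝ) (ξ : ℝ → EuclideanSpace ℝ (Fin m)),
      (∀ p, IntegrableOn (fun θ => ξ θ p) (Ioo (-Real.pi) Real.pi)) ∧
      (∀ᵐ p : ℝ × ℝ, p ∈ polarRect → u (polarPoint p.1 p.2) =
        p.1 • WithLp.toLp 2 fun i => k i + ∫ s in (0 : ℝ)..p.2, ξ s i) ∧
      ∀ᵐ p : ℝ × ℝ, p ∈ polarRect → Du (polarPoint p.1 p.2) =
        polarGrad p.2 (WithLp.toLp 2 fun i => k i + ∫ s in (0 : ℝ)..p.2, ξ s i) (ξ p.2) := by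
  have : IsFiniteMeasure (volume.restrict unitDisc) :=
    ⟨by rw [Measure.restrict_apply_univ]; exact measure_ball_lt_top⟩
  have hui : IntegrableOn u unitDisc := hu.memLp.integrable (by norm_num)
  have hDi : IntegrableOn Du unitDisc := hu.memLp_grad.integrable (by norm_num)
  set g : ℝ → EuclideanSpace ℝ (Fin m) := fun θ => (2 : ℝ) • u (polarPoint (1 / 2) θ) with hg
  have hhom : ∀ p ∈ polarRect, u (polarPoint p.1 p.2) = p.1 • g p.2 := fun p hp => by
    have h1 : (2 * p.1) • polarPoint (1 / 2) p.2 = polarPoint p.1 p.2 := by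
      ext i
      fin_cases i <;> simp [polarPoint] <;> ring
    have h2 := hom (polarPoint (1 / 2) p.2)
      (polarPoint_mem_unitDisc (by constructor <;> norm_num)).1 (2 * p.1)
      (by linarith [hp.1.1]) (by rw [h1]; exact (polarPoint_mem_unitDisc hp.1).1)
    rw [h1] at h2
    rw [h2, hg, smul_smul, mul_comm]
  have hcomp : ∀ i : Fin m, ∃ (k : ℝ) (ξ : ℝ → ℝ), IntegrableOn ξ (Ioo (-Real.pi) Real.pi) ∧
      (∀ᵐ θ, θ ∈ Ioo (-Real.pi) Real.pi → g θ i = k + ∫ s in (0 : ℝ)..θ, ξ s) ∧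
      ∀ᵐ p : ℝ × ℝ, p ∈ polarRect →
        Du (polarPoint p.1 p.2) i 0 = g p.2 i * Real.cos p.2 - ξ p.2 * Real.sin p.2 ∧
        Du (polarPoint p.1 p.2) i 1 = g p.2 i * Real.sin p.2 + ξ p.2 * Real.cos p.2 := fun i => by
    refine exists_polar_gradient (u := fun x => u x i) (D := fun q x => Du x i q) ?_ ?_ ?_ ?_
    · exact (PiLp.proj 2 (𝕜 := ℝ) (fun _ : Fin m => ℝ) i).integrable_comp hui
    · exact fun q => ((ContinuousLinearMap.proj (R := ℝ) (φ := fun _ : Fin 2 => ℝ) q).comp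
        (ContinuousLinearMap.proj (R := ℝ) (φ := fun _ : Fin m => Fin 2 → ℝ) i)).integrable_comp hDi
    · intro p hp
      simp only [hhom p hp, PiLp.smul_apply, smul_eq_mul]
    · exact fun φ hφ hφc hφs q => hu.weakGradient φ hφ hφc hφs i q
  choose k ξ hξ hk hD using hcomp
  have hk2 : ∀ᵐ p : ℝ × ℝ, p ∈ polarRect →
      g p.2 = WithLp.toLp 2 fun i => k i + ∫ s in (0 : ℝ)..p.2, ξ i s := by
    have h1 : ∀ᵐ θ, ∀ i, θ ∈ Ioo (-Real.pi) Real.pi → g θ i = k i + ∫ s in (0 : ℝ)..θ, ξ i s :=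
      ae_all_iff.2 hk
    filter_upwards [Measure.quasiMeasurePreserving_snd.ae h1] with p h hp
    ext i
    exact h i hp.2
  refine ⟨k, fun θ => WithLp.toLp 2 fun i => ξ i θ, hξ, ?_, ?_⟩
  · filter_upwards [hk2] with p h hp
    rw [hhom p hp, h hp]
  · filter_upwards [hk2, ae_all_iff.2 hD] with p h1 h2 hp
    rw [← h1 hp]
    ext i q
    fin_cases q
    · exact (h2 i hp).1
    · exact (h2 i hp).2

/-- For a continuous gradient, the equation holds classically in the angle, on every circle. -/
theorem hasDerivAt_angularPart_of_weak {m : ℕ} {A : Plane → Mat m → Mat m}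
    (hC1 : IsC1InGradient A) (hx : HasContinuousSpatialDerivatives A) {F : ℝ → Mat m}
    (hF : ContinuousOn F (Ioo (-Real.pi) Real.pi))
    (hw : ∀ (i : Fin m) (ψ : ℝ × ℝ → ℝ), IsPolarTest ψ → ∫ p in polarRect,
      (p.1 * radialPart p.2 (A (polarPoint p.1 p.2) (F p.2)) i * fderiv ℝ ψ p (1, 0) +
        angularPart p.2 (A (polarPoint p.1 p.2) (F p.2)) i * fderiv ℝ ψ p (0, 1)) = 0)
    {R θ : ℝ} (hR : R ∈ Ioo (0 : ℝ) 1) (hθ : θ ∈ Ioo (-Real.pi) Real.pi) :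
    HasDerivAt (fun t => angularPart t (A (polarPoint R t) (F t)))
      (-(radialPart θ (A (polarPoint R θ) (F θ)) +
        R • radialPart θ (Real.cos θ • partialX A 0 (polarPoint R θ) (F θ) +
          Real.sin θ • partialX A 1 (polarPoint R θ) (F θ)))) θ := by
  have hF2 : ∀ p ∈ polarRect, ContinuousAt (fun p : ℝ × ℝ => F p.2) p := fun p hp =>
    (hF.continuousAt (isOpen_Ioo.mem_nhds hp.2)).comp continuous_snd.continuousAt
  have hPF : ∀ p ∈ polarRect, ContinuousAt (fun p : ℝ × ℝ => (polarPoint p.1 p.2, F p.2)) p :=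
    fun p hp => continuous_polarPoint.continuousAt.prodMk (hF2 p hp)
  have cA : ∀ p ∈ polarRect, ContinuousAt (fun p : ℝ × ℝ => A (polarPoint p.1 p.2) (F p.2)) p :=
    fun p hp => (continuousAt_coeff hC1 hx (polarPoint_mem_unitDisc hp.1) (F p.2)).comp_of_eq
      (hPF p hp) rfl
  have cX : ∀ i, ∀ p ∈ polarRect,
      ContinuousAt (fun p : ℝ × ℝ => partialX A i (polarPoint p.1 p.2) (F p.2)) p :=
    fun i p hp => (continuousAt_partialX hx i (polarPoint_mem_unitDisc hp.1) (F p.2)).comp_of_eq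
      (hPF p hp) rfl
  have c2 : ∀ p : ℝ × ℝ, ContinuousAt (fun p : ℝ × ℝ => p.2) p := fun p =>
    continuous_snd.continuousAt
  have cD : ∀ p ∈ polarRect, ContinuousAt (fun p : ℝ × ℝ =>
      Real.cos p.2 • partialX A 0 (polarPoint p.1 p.2) (F p.2) +
        Real.sin p.2 • partialX A 1 (polarPoint p.1 p.2) (F p.2)) p := fun p hp =>
    ((Real.continuous_cos.continuousAt.comp (c2 p)).smul (cX 0 p hp)).add
      ((Real.continuous_sin.continuousAt.comp (c2 p)).smul (cX 1 p hp))
  have happ : ∀ (i : Fin m), Continuous fun v : EuclideanSpace ℝ (Fin m) => v i := fun i => by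
    fun_prop
  have cRad : ∀ {a : ℝ × ℝ → Mat m} (i : Fin m), (∀ p ∈ polarRect, ContinuousAt a p) →
      ContinuousOn (fun p => radialPart p.2 (a p) i) polarRect := fun {a} i h p hp =>
    ((happ i).continuousAt.comp (ContinuousAt.comp (x := p) (f := fun p : ℝ × ℝ => (p.2, a p))
      continuous_radialPart.continuousAt ((c2 p).prodMk (h p hp)))).continuousWithinAt
  have cAng : ∀ {a : ℝ × ℝ → Mat m} (i : Fin m), (∀ p ∈ polarRect, ContinuousAt a p) →
      ContinuousOn (fun p => angularPart p.2 (a p) i) polarRect := fun {a} i h p hp =>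
    ((happ i).continuousAt.comp (ContinuousAt.comp (x := p) (f := fun p : ℝ × ℝ => (p.2, a p))
      continuous_angularPart.continuousAt ((c2 p).prodMk (h p hp)))).continuousWithinAt
  have hpi : HasDerivAt (fun t (i : Fin m) => angularPart t (A (polarPoint R t) (F t)) i)
      (fun i => -(radialPart θ (A (polarPoint R θ) (F θ)) i +
        R * radialPart θ (Real.cos θ • partialX A 0 (polarPoint R θ) (F θ) +
          Real.sin θ • partialX A 1 (polarPoint R θ) (F θ)) i)) θ := by
    refine hasDerivAt_pi.2 fun i => ?_
    refine hasDerivAt_angular_of_weak (p := (R, θ))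
      (r := fun p => radialPart p.2 (A (polarPoint p.1 p.2) (F p.2)) i)
      (r' := fun p => radialPart p.2 (Real.cos p.2 • partialX A 0 (polarPoint p.1 p.2) (F p.2) +
        Real.sin p.2 • partialX A 1 (polarPoint p.1 p.2) (F p.2)) i)
      (q := fun p => angularPart p.2 (A (polarPoint p.1 p.2) (F p.2)) i)
      (fun p hp => ?_) (cRad i cA) (cRad i cD) (cAng i cA) (hw i) ⟨hR, hθ⟩
    have h1 := hasDerivAt_coeff_curve (A := A) hC1 hx ((hasDerivAt_id p.1).mul_const (Real.cos p.2))
      ((hasDerivAt_id p.1).mul_const (Real.sin p.2)) (hasDerivAt_const p.1 (F p.2))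
      (polarPoint_mem_unitDisc hp.1)
    rw [map_zero, add_zero, one_mul, one_mul] at h1
    have h0 := hasDerivAt_pi.1 (hasDerivAt_pi.1 h1 i)
    exact ((h0 0).mul_const (Real.cos p.2)).add ((h0 1).mul_const (Real.sin p.2))
  exact (PiLp.continuousLinearEquiv 2 ℝ (fun _ : Fin m => ℝ)).symm.hasFDerivAt.comp_hasDerivAt θ hpi

theorem theorem2 {m : ℕ} (A : Plane → Mat m → Mat m)
    (u : Plane → EuclideanSpace ℝ (Fin m)) (Du : Plane → Mat m)
    (hu : IsW12WithGradient u Du)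
    (hom : IsOneHomogeneous u)
    (hsol : IsDistributionalSolution A Du)
    (hell : IsUniformlyElliptic A)
    (hC1 : IsC1InGradient A)
    (hx : HasContinuousSpatialDerivatives A)
    (hlim : SpatialDerivativeVanishes A Du) :
    ∃ L : Plane →ₗ[ℝ] EuclideanSpace ℝ (Fin m), ∀ᵐ x ∂(volume.restrict unitDisc), u x = L x := by
  obtain ⟨ν, hν, hA⟩ := hell
  change IsEllipticWith A ν at hA
  have hpi := Real.pi_pos
  set I : Set ℝ := Ioo (-Real.pi) Real.pi with hI
  have h0I : (0 : ℝ) ∈ I := by constructor <;> linarith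
  obtain ⟨k, ξ₁, hξ₁, hu₁, hDu₁⟩ := exists_polar_structure hu hom
  set g : ℝ → EuclideanSpace ℝ (Fin m) := fun θ =>
    WithLp.toLp 2 fun i => k i + ∫ s in (0 : ℝ)..θ, ξ₁ s i with hg
  have hgc : ContinuousOn g I := by
    refine (PiLp.continuous_toLp 2 _).comp_continuousOn (continuousOn_pi.2 fun i => ?_)
    exact continuousOn_const.add ((continuousOn_primitive_of_integrableOn (by linarith)
      (by constructor <;> linarith) (hξ₁ i)).mono Ioo_subset_Icc_self)
  -- the angular component of the gradient has a continuous representative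
  obtain ⟨β, hβ, hβc, hβs, hβ0, hβ1⟩ := exists_bump_integral_eq_one (one_half_pos (α := ℝ))
  have hβs1 : tsupport β ⊆ Ioo 0 1 := hβs.trans (Ioo_subset_Ioo_right (by norm_num))
  choose K hKc hK using fun i => hsol.exists_continuousOn_average i hβ hβc hβs
  have hray₁ := ae_ae_of_ae_polarRect
    (P := fun R θ => Du (polarPoint R θ) = polarGrad θ (g θ) (ξ₁ θ)) hDu₁
  have hKΦ : ∀ᵐ θ, θ ∈ I → WithLp.toLp 2 (fun i => K i θ) = averagedFlux A β (θ, g θ, ξ₁ θ) := by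
    filter_upwards [ae_all_iff.2 hK, hray₁] with θ h1 h2 hθ
    ext i
    rw [averagedFlux_apply hC1 hx hβ.continuous hβc hβs1]
    refine (h1 i hθ).trans (integral_congr_ae ((ae_restrict_iff' measurableSet_Ioo).2 ?_))
    filter_upwards [h2 hθ] with R hR hRI
    rw [hR hRI]
  obtain ⟨ξ, hξc, hξ⟩ := exists_continuousOn_ae_eq_of_monotone
    (continuous_averagedFlux hC1 hx hβ.continuous hβc hβs1)
    (mul_pos hν (integral_mul_bump_pos hβ.continuous hβs1 hβ0 hβ1)) isOpen_Ioo
    (le_inner_averagedFlux_sub hA hC1 hx hβ.continuous hβc hβs1 hβ0) hgc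
    ((PiLp.continuous_toLp 2 _).comp_continuousOn (continuousOn_pi.2 hKc)) hKΦ
  have hgd : ∀ θ ∈ I, HasDerivAt g (ξ θ) θ := by
    intro θ hθ
    have hi : ∀ i : Fin m, HasDerivAt (fun θ => k i + ∫ s in (0 : ℝ)..θ, ξ s i) (ξ θ i) θ := by
      intro i
      have hc : ContinuousOn (fun θ => ξ θ i) I :=
        (show Continuous fun v : EuclideanSpace ℝ (Fin m) => v i by fun_prop).comp_continuousOn hξc
      refine (intervalIntegral.integral_hasDerivAt_right (ContinuousOn.intervalIntegrable
        (hc.mono ((convex_Ioo _ _).ordConnected.uIcc_subset h0I hθ)))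
        (hc.stronglyMeasurableAtFilter isOpen_Ioo θ hθ)
        (hc.continuousAt (isOpen_Ioo.mem_nhds hθ))).const_add (k i)
    have hd : HasDerivAt (fun θ (i : Fin m) => k i + ∫ s in (0 : ℝ)..θ, ξ₁ s i)
        (fun i => ξ θ i) θ := by
      refine hasDerivAt_pi.2 fun i => (hi i).congr_of_eventuallyEq ?_
      filter_upwards [isOpen_Ioo.mem_nhds hθ] with t ht
      congr 1
      refine intervalIntegral.integral_congr_ae ?_
      filter_upwards [hξ] with s hs hsm
      rw [hs ((convex_Ioo _ _).ordConnected.uIcc_subset h0I ht (uIoc_subset_uIcc hsm))]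
    exact (PiLp.continuousLinearEquiv 2 ℝ (fun _ : Fin m => ℝ)).symm.hasFDerivAt.comp_hasDerivAt
      θ hd
  set F : ℝ → Mat m := fun θ => polarGrad θ (g θ) (ξ θ) with hF
  have hFc : ContinuousOn F I :=
    continuous_polarGrad.comp_continuousOn (continuousOn_id.prodMk (hgc.prodMk hξc))
  have hDu : ∀ᵐ p : ℝ × ℝ, p ∈ polarRect → Du (polarPoint p.1 p.2) = F p.2 := by
    filter_upwards [hDu₁, Measure.quasiMeasurePreserving_snd.ae hξ] with p h1 h2 hp
    rw [h1 hp, h2 hp.2]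
  -- the equation holds on each circle, so that `ξ` is differentiable
  have hode : ∀ θ ∈ I, ∀ R ∈ Ioo (0 : ℝ) 1, ∃ w, HasDerivAt ξ w θ ∧
      ν * ‖w + g θ‖ ≤ ‖R • divX A (polarPoint R θ) (F θ)‖ := by
    intro θ hθ R hR
    refine exists_hasDerivAt_of_flux hν hA hC1 hx hR (hgd θ hθ) ?_
    refine hasDerivAt_angularPart_of_weak hC1 hx hFc (fun i ψ hψ => ?_) hR hθ
    refine (integral_congr_ae ((ae_restrict_iff' measurableSet_polarRect).2 ?_)).trans
      (hsol.polar i hψ)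
    filter_upwards [hDu] with p hp hpQ
    rw [hp hpQ]
  have hhalf : (1 / 2 : ℝ) ∈ Ioo (0 : ℝ) 1 := by constructor <;> norm_num
  have hξd : ∀ θ ∈ I, DifferentiableAt ℝ ξ θ := fun θ hθ => by
    obtain ⟨w, hw, -⟩ := hode θ hθ _ hhalf
    exact hw.differentiableAt
  have hray := ae_ae_of_ae_polarRect (P := fun R θ => Du (polarPoint R θ) = F θ) hDu
  -- letting `R → 0` along almost every ray removes the right-hand side
  have hξae : ∀ᵐ θ, θ ∈ I → HasDerivAt ξ (-g θ) θ := by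
    filter_upwards [hlim 0, hlim 1, hray] with θ l0 l1 hrayθ hθ
    have hne := neBot_nhdsGT_inf_ae
    obtain ⟨w, hw, -⟩ := hode θ hθ _ hhalf
    have hlimdiv : Tendsto (fun R : ℝ => ‖(WithLp.toLp 2 fun i : Fin m =>
        (R • partialX A 0 (polarPoint R θ) (Du (polarPoint R θ))) i 0 +
          (R • partialX A 1 (polarPoint R θ) (Du (polarPoint R θ))) i 1 :
            EuclideanSpace ℝ (Fin m))‖) (𝓝[>] (0 : ℝ) ⊓ ae volume) (𝓝 0) := by
      have hcont : Continuous fun z : Mat m × Mat m =>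
          ‖(WithLp.toLp 2 fun i : Fin m => z.1 i 0 + z.2 i 1 : EuclideanSpace ℝ (Fin m))‖ :=
        ((PiLp.continuous_toLp 2 _).comp (continuous_pi fun i => by fun_prop)).norm
      have h1 := (hcont.tendsto (0, 0)).comp (l0.prodMk_nhds l1)
      have h2 : ‖(WithLp.toLp 2 fun i : Fin m => (0 : Mat m) i 0 + (0 : Mat m) i 1 :
          EuclideanSpace ℝ (Fin m))‖ = 0 := by
        rw [norm_eq_zero]
        ext i
        simp
      simp only [h2] at h1
      exact h1
    have hle : ∀ᶠ R in 𝓝[>] (0 : ℝ) ⊓ ae volume, ν * ‖w + g θ‖ ≤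
        ‖(WithLp.toLp 2 fun i : Fin m =>
          (R • partialX A 0 (polarPoint R θ) (Du (polarPoint R θ))) i 0 +
            (R • partialX A 1 (polarPoint R θ) (Du (polarPoint R θ))) i 1 :
              EuclideanSpace ℝ (Fin m))‖ := by
      have e1 : ∀ᶠ R in 𝓝[>] (0 : ℝ) ⊓ ae volume, R ∈ Ioo (0 : ℝ) 1 :=
        mem_inf_of_left (Ioo_mem_nhdsGT one_pos)
      have e2 : ∀ᶠ R in 𝓝[>] (0 : ℝ) ⊓ ae volume,
          R ∈ Ioo (0 : ℝ) 1 → Du (polarPoint R θ) = F θ := mem_inf_of_right (hrayθ hθ)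
      filter_upwards [e1, e2] with R hR hRD
      obtain ⟨w', hw', hle'⟩ := hode θ hθ R hR
      rw [hw'.unique hw] at hle'
      refine hle'.trans_eq (congrArg _ ?_)
      rw [hRD hR]
      ext i
      simp only [divX, PiLp.smul_apply, Pi.smul_apply, smul_eq_mul]
      ring
    have h0 : ν * ‖w + g θ‖ ≤ 0 := ge_of_tendsto hlimdiv hle
    have h1 : ‖w + g θ‖ = 0 := le_antisymm (by nlinarith [norm_nonneg (w + g θ)]) (norm_nonneg _)
    rwa [eq_neg_of_add_eq_zero_left (norm_eq_zero.1 h1)] at hw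
  have hsolve : ∀ θ ∈ I, g θ = Real.cos θ • g 0 + Real.sin θ • ξ 0 := fun θ hθ =>
    eq_cos_add_sin_of_ae h0I hgd hξd hξae hθ
  refine ⟨(EuclideanSpace.proj (𝕜 := ℝ) (0 : Fin 2) : Plane →L[ℝ] ℝ).toLinearMap.smulRight (g 0) +
    (EuclideanSpace.proj (𝕜 := ℝ) (1 : Fin 2) : Plane →L[ℝ] ℝ).toLinearMap.smulRight (ξ 0), ?_⟩
  refine (ae_restrict_iff' Metric.isOpen_ball.measurableSet).2 (ae_unitDisc_iff_polar.2 ?_)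
  filter_upwards [hu₁] with p hp hpQ
  rw [hp hpQ]
  change p.1 • g p.2 = (p.1 * Real.cos p.2) • g 0 + (p.1 * Real.sin p.2) • ξ 0
  rw [hsolve p.2 hpQ.2]
  module
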